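/- Let $d\ge 1$, let $\Omega$ be the uniform ensemble (the unitarily invariant probability measure on the unit vectors $\psi\in\mathbb C^d$), and let $dU$ be the normalized Haar measure on $U(d)$. Definitions. A POVM on a measurable outcome space $X$ is given by a $\sigma$-finite measure $\nu$ on $X$ and a measurable family of positive operators $F_x$ on $\mathbb C^d$ with $\int F_x\,d\nu(x)=I$ (finite POVMs are the case of counting measure on a finite set). An operation $\mathcal A(\rho)=\sum_i A_i\rho A_i^\dagger$ (finite sum) is compatible with the effect $\sum_i A_i^\dagger A_i$. An instrument for $(F_x,\nu)$ is a measurable family of operations $\mathcal A_x$, each compatible with $F_x$; the pair is called a procedure, and its overall operation is $\mathcal A(\rho)=\int\mathcal A_x(\rho)\,d\nu(x)$. Its disturbance is $$\overline D=1-\int d\Omega(\psi)\int d\nu(x)\,F\big(|\psi\rangle\langle\psi|,\mathcal A_x(|\psi\rangle\langle\psi|)\big),\qquad F(\rho,\sigma)=\Big(\operatorname{tr}\sqrt{\rho^{1/2}\sigma\rho^{1/2}}\Big)^2 .$$ Its information gain $I$ is the mutual information between $\psi\sim\Omega$ and the outcome: with $p(x|\psi)=\langle\psi|F_x|\psi\rangle$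 and $p(x)=\int p(x|\psi)\,d\Omega(\psi)$, $$I=\int d\Omega(\psi)\int d\nu(x)\,p(x|\psi)\log\frac{p(x|\psi)}{p(x)} .$$ The square-root dynamics of a POVM is the instrument $\mathcal A_x(\rho)=F_x^{1/2}\rho F_x^{1/2}$. The Haar twirl of $(F_x,\nu)$ is the POVM on $X\times U(d)$ with reference measure $d\nu(x)\,dU$ and effects $UF_xU^\dagger$. An operation $\mathcal A$ is unitarily covariant if $W^\dagger\mathcal A(W\rho W^\dagger)W=\mathcal A(\rho)$ for all unitary $W$ and all operators $\rho$. For real $p$ let $\mathcal A_p(\rho)=(1-p)\rho+p\,(\operatorname{tr}\rho)\,I/d$. Theorem. 1. For every procedure, with information gain $I$ say, there is a finite POVM $\{G_b\}$ such that the Haar twirl of $\{G_b\}$ with its square-root dynamics is a procedure which has information gain $I$, whose disturbance is at most that of every procedure with information gain $I$, and whose overall operation is unitarily covariant and equal to $\mathcal A_p$ for some $p\in[0,1]$. 2. For every POVM $(F_x,\nu)$, the Haar twirl with its square-root dynamics is a procedure with the same information gain as $(F_x,\nu)$. Its disturbance is the minimum of the disturbances of all instruments for $(F_x,\nu)$,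 and also the minimum of the disturbances of all instruments for the twirled POVM. Its overall operation is unitarily covariant and equal to $\mathcal A_p$ for some $p\in[0,1]$. 3. For a finite POVM the information gain equals $H(B)-H(B|\Psi)$, where $H(B)=-\sum_b p(b)\log p(b)$ and $H(B|\Psi)=-\int d\Omega(\psi)\sum_b p(b|\psi)\log p(b|\psi)$. 4. A trace-preserving completely positive map $\mathcal A$ on the operators of $\mathbb C^d$ is unitarily covariant if and only if $\mathcal A=\mathcal A_p$ for some real $p\ge 0$ with $p(d^2-1)\le d^2$. -/

import Mathlib

open MeasureTheory Matrix
open scoped ComplexOrder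

noncomputable section

namespace QuantumMeasurement

/-- Linear operators on the Hilbert space `ℂ ^ d`. -/
abbrev Op (d : ℕ) : Type := Matrix (Fin d) (Fin d) ℂ

/-- The unitary group `U(d)`, with the topology of matrices. -/
abbrev UGroup (d : ℕ) : Type := Matrix.unitaryGroup (Fin d) ℂ

instance instCompactSpaceUGroup (d : ℕ) : CompactSpace (UGroup d) := by
  have hc : IsClosed ((Matrix.unitaryGroup (Fin d) ℂ : Set (Op d))) := isClosed_unitary
  have hK : IsCompact ({A : Fin d → Fin d → ℂ | ∀ i, A i ∈
      {v : Fin d → ℂ | ∀ j, v j ∈ Metric.closedBall (0 : ℂ) 1}}) :=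
    isCompact_pi_infinite fun _ =>
      isCompact_pi_infinite fun _ => isCompact_closedBall (0 : ℂ) 1
  refine isCompact_iff_compactSpace.mp (IsCompact.of_isClosed_subset hK hc ?_)
  intro A hA i j
  simpa using entry_norm_bound_of_unitary hA i j

/-- `U(d)` carries its Borel sigma-algebra. -/
instance instMeasurableSpaceUGroup (d : ℕ) : MeasurableSpace (UGroup d) := borel _

instance instBorelSpaceUGroup (d : ℕ) : BorelSpace (UGroup d) := ⟨rfl⟩

/-- Haar measure on `U(d)`, normalized to total mass `1`. -/
def haarU (d : ℕ) : Measure (UGroup d) :=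
  Measure.haarMeasure (⊤ : TopologicalSpace.PositiveCompacts (UGroup d))

/-- The uniform ensemble `Ω`: the unitarily invariant probability measure on the unit vectors of
`ℂ ^ d`, that is, the law of `U e₀` for a Haar distributed unitary `U`. -/
def uniformEnsemble (d : ℕ) [NeZero d] : Measure (Fin d → ℂ) :=
  Measure.map (fun U : UGroup d => (U : Op d) *ᵥ Pi.single 0 1) (haarU d)

/-- The operator `|ψ⟩⟨ψ|`. -/
def ketbra {d : ℕ} (ψ : Fin d → ℂ) : Op d := Matrix.vecMulVec ψ (star ψ)

/-- The positive square root of a positive operator (continuous functional calculus). -/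
def sqrtOp {d : ℕ} (A : Op d) : Op d := cfc Real.sqrt A

/-- The fidelity `(tr √(ρ^{1/2} σ ρ^{1/2}))²`; the second argument may be unnormalized. -/
def fidelity {d : ℕ} (ρ σ : Op d) : ℝ :=
  (sqrtOp (sqrtOp ρ * σ * sqrtOp ρ)).trace.re ^ 2

/-- The integral of an operator valued function, entry by entry. -/
def opIntegral {d : ℕ} {X : Type*} [MeasurableSpace X] (ν : Measure X) (F : X → Op d) : Op d :=
  Matrix.of fun i j => ∫ x, F x i j ∂ν

/-- The infinitesimal effects `F x dν(x)` form a POVM on the outcome space `X`: the effect of a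
measurable set `Δ` of outcomes is `∫_Δ F dν`. Discrete POVMs are the case where `ν` is the
counting measure. -/
structure IsPOVM {d : ℕ} {X : Type*} [MeasurableSpace X] (ν : Measure X) (F : X → Op d) :
    Prop where
  measurable : ∀ i j, Measurable fun x => F x i j
  posSemidef : ∀ x, (F x).PosSemidef
  integrable : ∀ i j, Integrable (fun x => F x i j) ν
  integral_eq_one : opIntegral ν F = 1

/-- The operators `A i` form a Hellwig-Kraus decomposition of the operation `𝒜`. -/
def IsKrausDecomposition {d : ℕ} {ι : Type*} [Fintype ι] (A : ι → Op d) (𝒜 : Op d → Op d) :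
    Prop :=
  ∀ ρ, 𝒜 ρ = ∑ i, A i * ρ * (A i)ᴴ

/-- The operation `𝒜` is compatible with the effect `E`. -/
def IsCompatible {d : ℕ} (E : Op d) (𝒜 : Op d → Op d) : Prop :=
  ∃ (r : ℕ) (A : Fin r → Op d), IsKrausDecomposition A 𝒜 ∧ ∑ i, (A i)ᴴ * A i = E

/-- A trace-preserving completely positive map. -/
def IsChannel {d : ℕ} (𝒜 : Op d → Op d) : Prop := IsCompatible 1 𝒜

/-- A measurement procedure: a POVM `F x dν(x)` together with a compatible instrument
`𝒜 x dν(x)`. -/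
structure IsProcedure {d : ℕ} {X : Type*} [MeasurableSpace X] (ν : Measure X) (F : X → Op d)
    (𝒜 : X → Op d → Op d) : Prop where
  povm : IsPOVM ν F
  measurable : ∀ ρ i j, Measurable fun x => 𝒜 x ρ i j
  compatible : ∀ x, IsCompatible (F x) (𝒜 x)

/-- The overall operation `ρ ↦ ∫ 𝒜 x ρ dν(x)`, the outcome being ignored. -/
def overallOperation {d : ℕ} {X : Type*} [MeasurableSpace X] (ν : Measure X)
    (𝒜 : X → Op d → Op d) : Op d → Op d :=
  fun ρ => opIntegral ν fun x => 𝒜 x ρ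

/-- The average disturbance to the uniform ensemble: one minus the fidelity of the input to the
conditional outputs, averaged over inputs and outcomes. -/
def disturbance {d : ℕ} [NeZero d] {X : Type*} [MeasurableSpace X] (ν : Measure X)
    (𝒜 : X → Op d → Op d) : ℝ :=
  1 - ∫ ψ, (∫ x, fidelity (ketbra ψ) (𝒜 x (ketbra ψ)) ∂ν) ∂(uniformEnsemble d)

/-- The outcome probability (density) `tr (E |ψ⟩⟨ψ|) = ⟨ψ|E|ψ⟩` given the input `ψ`. -/
def condProb {d : ℕ} (E : Op d) (ψ : Fin d → ℂ) : ℝ := (E * ketbra ψ).trace.re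

/-- The outcome probability (density) for a random input from the uniform ensemble. -/
def meanProb {d : ℕ} [NeZero d] (E : Op d) : ℝ := ∫ ψ, condProb E ψ ∂(uniformEnsemble d)

/-- The information gain: the mutual information of the input `Ψ` (uniform ensemble) and the
outcome `B`, `∫∫ p(x|ψ) log (p(x|ψ) / p(x)) dν(x) dΩ(ψ)`. -/
def information {d : ℕ} [NeZero d] {X : Type*} [MeasurableSpace X] (ν : Measure X)
    (F : X → Op d) : ℝ :=
  ∫ ψ, (∫ x, condProb (F x) ψ * Real.log (condProb (F x) ψ / meanProb (F x)) ∂ν)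
    ∂(uniformEnsemble d)

/-- `H(B)`, for a finite POVM. -/
def outcomeEntropy {d : ℕ} [NeZero d] {ι : Type*} [Fintype ι] (F : ι → Op d) : ℝ :=
  ∑ b, Real.negMulLog (meanProb (F b))

/-- `H(B|Ψ)`, for a finite POVM. -/
def condOutcomeEntropy {d : ℕ} [NeZero d] {ι : Type*} [Fintype ι] (F : ι → Op d) : ℝ :=
  ∫ ψ, (∑ b, Real.negMulLog (condProb (F b) ψ)) ∂(uniformEnsemble d)

/-- The square-root dynamics of a POVM. -/
def sqrtDynamics {d : ℕ} {X : Type*} (F : X → Op d) : X → Op d → Op d :=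
  fun x ρ => sqrtOp (F x) * ρ * sqrtOp (F x)

/-- The effects of the Haar twirl of a POVM: the outcomes are pairs `(x, U)`, the effects are
`U F_x U† dν(x) dU`. -/
def twirl {d : ℕ} {X : Type*} (F : X → Op d) : X × UGroup d → Op d :=
  fun y => (y.2 : Op d) * F y.1 * (y.2 : Op d)ᴴ

/-- The reference measure `dν(x) dU` of the Haar twirl. -/
def twirlMeasure (d : ℕ) {X : Type*} [MeasurableSpace X] (ν : Measure X) :
    Measure (X × UGroup d) :=
  ν.prod (haarU d)

/-- `W† 𝒜(W ρ W†) W = 𝒜(ρ)` for all unitaries `W` and all `ρ`. -/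
def IsUnitarilyCovariant {d : ℕ} (𝒜 : Op d → Op d) : Prop :=
  ∀ (W : UGroup d) (ρ : Op d),
    (W : Op d)ᴴ * 𝒜 ((W : Op d) * ρ * (W : Op d)ᴴ) * (W : Op d) = 𝒜 ρ

/-- The linear extension of `ρ ↦ (1 - p) ρ + p I / d` from density operators to all operators. -/
def depolarizing {d : ℕ} (p : ℝ) : Op d → Op d :=
  fun ρ => ((1 - p : ℝ) : ℂ) • ρ + ((p / d : ℝ) * ρ.trace) • (1 : Op d)

end QuantumMeasurement

end

open QuantumMeasurement

/-!
Both the disturbance and the information gain of a procedure are integrals over the outcomes. For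
an outcome with effect `E` and Kraus operators `A i`, covariance determines the second moment of
the uniform ensemble, so that the average fidelity is `(tr E + ∑ i, |tr (A i)|²) / (d (d + 1))`.
Minkowski's inequality for the diagonal entries of the `A i` in an eigenbasis of `E` gives
`∑ i, |tr (A i)|² ≤ (tr √E)²`, with equality for the square-root dynamics. This optimal fidelity
and the information density depend only on `E`, are unitarily invariant, and are homogeneous of
degree one in `E`. Invariance shows that the Haar twirl changes neither the information gain nor
the minimal disturbance. Homogeneity shows that the pairs (information gain, optimal fidelity) of
all POVMs lie in `d • convexHull K`, where `K` is the compact set of pairs of diagonal effects of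
unit trace. Conversely every point of `d • convexHull K` comes from a finite POVM, since the cyclic
shifts of a diagonal effect add up to a multiple of the identity. Maximizing the fidelity over a
slice of this compact set produces the optimal finite POVM.

A covariant linear map sends `|e₀⟩⟨e₀|` into the commutant of the stabilizer of `e₀`, hence it is a
combination of the identity and `ρ ↦ (tr ρ) I`. For a trace-preserving map with Kraus operators
`A i` the parameter `p` is then read off from the superoperator trace `∑ i, |tr (A i)|²`.
-/

namespace QuantumMeasurement

variable {d : ℕ}

section Matrices

variable {n : Type*} [DecidableEq n]

/-- The real diagonal operator with entries `l i`. -/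
noncomputable def diagOp (l : n → ℝ) : Matrix n n ℂ := diagonal fun i => (l i : ℂ)

theorem posSemidef_diagOp {l : n → ℝ} (hl : ∀ i, 0 ≤ l i) : (diagOp l).PosSemidef :=
  PosSemidef.diagonal fun i => by simpa using hl i

theorem diagOp_smul (c : ℝ) (l : n → ℝ) : diagOp (c • l) = (c : ℂ) • diagOp l := by
  rw [diagOp, diagOp, ← diagonal_smul]
  congr 1
  ext i
  simp

theorem exists_eq_smul_single_add_smul_one {T : Matrix n n ℂ} {i₀ : n}
    (hoff : ∀ k l, k ≠ l → T k l = 0) (hdiag : ∀ k l, k ≠ i₀ → l ≠ i₀ → T k k = T l l) :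
    ∃ a b : ℂ, T = a • single i₀ i₀ 1 + b • 1 := by
  obtain ⟨b, hb⟩ : ∃ b, ∀ k, k ≠ i₀ → T k k = b := by
    by_cases h : ∃ k, k ≠ i₀
    · obtain ⟨k, hk⟩ := h
      exact ⟨T k k, fun l hl => hdiag l k hl hk⟩
    · exact ⟨0, fun k hk => (h ⟨k, hk⟩).elim⟩
  refine ⟨T i₀ i₀ - b, b, ?_⟩
  ext i j
  rcases eq_or_ne i j with rfl | hij
  · rcases eq_or_ne i₀ i with rfl | hi
    · simp
    · simp [hb i hi.symm, hi]
  · rcases eq_or_ne i₀ i with rfl | hi <;> simp [hoff _ _ hij, *]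

variable [Fintype n]

theorem conjTranspose_mul_coe (V : unitaryGroup n ℂ) : V.1ᴴ * V.1 = 1 :=
  Unitary.coe_star_mul_self V

theorem coe_mul_conjTranspose (V : unitaryGroup n ℂ) : V.1 * V.1ᴴ = 1 :=
  Unitary.coe_mul_star_self V

theorem conj_mul_conj (V : unitaryGroup n ℂ) (A B : Matrix n n ℂ) :
    (V.1 * A * V.1ᴴ) * (V.1 * B * V.1ᴴ) = V.1 * (A * B) * V.1ᴴ :=
  (map_mul (Unitary.conjStarAlgAut ℂ (Matrix n n ℂ) V) A B).symm

theorem conj_conj (V W : unitaryGroup n ℂ) (A : Matrix n n ℂ) :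
    V.1 * (W.1 * A * W.1ᴴ) * V.1ᴴ = (V * W).1 * A * (V * W).1ᴴ := by
  simp only [Submonoid.coe_mul, conjTranspose_mul, Matrix.mul_assoc]

theorem trace_conj (V : unitaryGroup n ℂ) (A : Matrix n n ℂ) :
    (V.1 * A * V.1ᴴ).trace = A.trace := by
  rw [Matrix.trace_mul_cycle, conjTranspose_mul_coe, Matrix.one_mul]

theorem trace_diagOp (l : n → ℝ) : (diagOp l).trace = (∑ i, l i : ℝ) := by
  simp [diagOp]

theorem diagOp_mul_diagOp (l m : n → ℝ) : diagOp l * diagOp m = diagOp (l * m) := by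
  simp [diagOp, diagonal_mul_diagonal]

theorem exists_diagonalization_of_isHermitian {A : Matrix n n ℂ} (hA : A.IsHermitian) :
    ∃ V : unitaryGroup n ℂ, A = V.1 * diagOp hA.eigenvalues * V.1ᴴ :=
  ⟨hA.eigenvectorUnitary, by
    simpa only [Unitary.conjStarAlgAut_apply] using! hA.spectral_theorem⟩

theorem exists_diagonalization {A : Matrix n n ℂ} (hA : A.PosSemidef) :
    ∃ (V : unitaryGroup n ℂ) (l : n → ℝ), (∀ i, 0 ≤ l i) ∧ A = V.1 * diagOp l * V.1ᴴ :=
  let ⟨V, hV⟩ := exists_diagonalization_of_isHermitian hA.isHermitian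
  ⟨V, _, hA.eigenvalues_nonneg, hV⟩

/-- The unitary matrix that permutes the standard basis. -/
noncomputable def permUnitary (σ : Equiv.Perm n) : unitaryGroup n ℂ :=
  ⟨σ.permMatrix ℂ, by
    rw [mem_unitaryGroup_iff, star_eq_conjTranspose, conjTranspose_permMatrix, ← permMatrix_mul]
    simp⟩

theorem permUnitary_conj (σ : Equiv.Perm n) (A : Matrix n n ℂ) :
    (permUnitary σ).1 * A * (permUnitary σ).1ᴴ = A.submatrix σ σ := by
  change σ.permMatrix ℂ * A * (σ.permMatrix ℂ)ᴴ = _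
  rw [conjTranspose_permMatrix, Equiv.Perm.permMatrix, PEquiv.toMatrix_toPEquiv_mul,
    Equiv.Perm.permMatrix, PEquiv.mul_toMatrix_toPEquiv]
  rfl

theorem permUnitary_conj_single (σ : Equiv.Perm n) (i : n) :
    (permUnitary σ).1 * single (σ i) (σ i) 1 * (permUnitary σ).1ᴴ = single i i 1 := by
  rw [permUnitary_conj, submatrix_single_equiv, Equiv.symm_apply_apply]

/-- The unitary matrix that flips the sign of the `k`-th coordinate. -/
def signUnitary (k : n) : unitaryGroup n ℂ :=
  ⟨diagonal fun j => if j = k then -1 else 1, by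
    rw [mem_unitaryGroup_iff, star_eq_conjTranspose, diagonal_conjTranspose,
      diagonal_mul_diagonal, ← diagonal_one]
    congr 1
    ext j
    by_cases h : j = k <;> simp [h]⟩

theorem signUnitary_conj_apply (k : n) (A : Matrix n n ℂ) (i j : n) :
    ((signUnitary k).1 * A * (signUnitary k).1ᴴ) i j =
      (if i = k then -1 else 1) * A i j * (if j = k then -1 else 1) := by
  rw [signUnitary]
  rw [diagonal_conjTranspose, mul_diagonal, diagonal_mul]
  congr 1
  by_cases h : j = k <;> simp [h]

theorem signUnitary_conj_single (k i : n) :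
    (signUnitary k).1 * single i i 1 * (signUnitary k).1ᴴ = single i i 1 := by
  ext a b
  rw [signUnitary_conj_apply]
  rcases eq_or_ne i a with rfl | ha
  · rcases eq_or_ne i b with rfl | hb
    · split_ifs <;> simp
    · simp [hb]
  · simp [ha]

theorem exists_eq_of_commutes_stabilizer {T : Matrix n n ℂ} {i₀ : n}
    (hT : ∀ W : unitaryGroup n ℂ, W.1 * single i₀ i₀ 1 * W.1ᴴ = single i₀ i₀ 1 →
      W.1 * T * W.1ᴴ = T) :
    ∃ a b : ℂ, T = a • single i₀ i₀ 1 + b • 1 := by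
  refine exists_eq_smul_single_add_smul_one (fun k l hkl => ?_) fun k l hk hl => ?_
  · have h := congrFun₂ (hT (signUnitary k) (signUnitary_conj_single k i₀)) k l
    rw [signUnitary_conj_apply, if_pos rfl, if_neg hkl.symm] at h
    linear_combination (-1 / 2 : ℂ) * h
  · have hswap := permUnitary_conj_single (Equiv.swap k l) i₀
    rw [Equiv.swap_apply_of_ne_of_ne hk.symm hl.symm] at hswap
    have h := congrFun₂ (hT _ hswap) l l
    rwa [permUnitary_conj, submatrix_apply, Equiv.swap_apply_right] at h

theorem span_conj_single (i₀ : n) :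
    Submodule.span ℂ (Set.range fun W : unitaryGroup n ℂ => W.1 * single i₀ i₀ 1 * W.1ᴴ) = ⊤ := by
  have hherm (A : Matrix n n ℂ) (hA : A.IsHermitian) : A ∈ Submodule.span ℂ
      (Set.range fun W : unitaryGroup n ℂ => W.1 * single i₀ i₀ 1 * W.1ᴴ) := by
    obtain ⟨V, hV⟩ := exists_diagonalization_of_isHermitian hA
    have hsum : diagOp hA.eigenvalues =
        ∑ i, (hA.eigenvalues i : ℂ) • single i i (1 : ℂ) := by
      simp only [diagOp, ← sum_single_eq_diagonal, smul_single, smul_eq_mul, mul_one]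
    rw [hV, hsum, Finset.mul_sum, Finset.sum_mul]
    refine Submodule.sum_mem _ fun i _ => ?_
    rw [Matrix.mul_smul, Matrix.smul_mul, ← permUnitary_conj_single (Equiv.swap i i₀) i,
      Equiv.swap_apply_left, conj_conj]
    exact Submodule.smul_mem _ _ (Submodule.subset_span ⟨_, rfl⟩)
  refine Submodule.eq_top_iff'.2 fun A => ?_
  rw [← realPart_add_I_smul_imaginaryPart A]
  exact Submodule.add_mem _ (hherm _ (realPart A).2)
    (Submodule.smul_mem _ _ (hherm _ (imaginaryPart A).2))

theorem linearMap_ext_conj_single {M : Type*} [AddCommGroup M] [Module ℂ M] (i₀ : n)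
    {f g : Matrix n n ℂ →ₗ[ℂ] M} (h : ∀ W : unitaryGroup n ℂ,
      f (W.1 * single i₀ i₀ 1 * W.1ᴴ) = g (W.1 * single i₀ i₀ 1 * W.1ᴴ)) : f = g :=
  LinearMap.ext_on_range (span_conj_single i₀) h

/-- Covariant maps are determined by their value on one rank-one projection, and that value
commutes with the stabilizer of the projection. -/
theorem exists_eq_of_covariant [Nonempty n] (𝒜 : Matrix n n ℂ →ₗ[ℂ] Matrix n n ℂ)
    (h𝒜 : ∀ (W : unitaryGroup n ℂ) (ρ : Matrix n n ℂ),
      𝒜 (W.1 * ρ * W.1ᴴ) = W.1 * 𝒜 ρ * W.1ᴴ) :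
    ∃ a b : ℂ, 𝒜 = a • LinearMap.id + (b • traceLinearMap n ℂ ℂ).smulRight 1 := by
  obtain ⟨i₀⟩ := ‹Nonempty n›
  obtain ⟨a, b, hab⟩ := exists_eq_of_commutes_stabilizer (T := 𝒜 (single i₀ i₀ 1)) (i₀ := i₀)
    fun W hW => by rw [← h𝒜, hW]
  refine ⟨a, b, linearMap_ext_conj_single i₀ fun W => ?_⟩
  simp [-smul_single, h𝒜, hab, trace_conj, Matrix.mul_add, Matrix.add_mul,
    coe_mul_conjTranspose]

theorem card_smul_eq_trace_smul_of_conj_invariant {M : Type*} [AddCommGroup M] [Module ℂ M]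
    (f : Matrix n n ℂ →ₗ[ℂ] M)
    (hf : ∀ (W : unitaryGroup n ℂ) (A : Matrix n n ℂ), f (W.1 * A * W.1ᴴ) = f A)
    (A : Matrix n n ℂ) : (Fintype.card n : ℂ) • f A = A.trace • f 1 := by
  cases isEmpty_or_nonempty n
  · simp [trace]
  obtain ⟨i₀⟩ := ‹Nonempty n›
  have hf_eq : f = (traceLinearMap n ℂ ℂ).smulRight (f (single i₀ i₀ 1)) :=
    linearMap_ext_conj_single i₀ fun W => by simp [hf, trace_conj]
  rw [hf_eq]
  simp [smul_smul, mul_comm]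

theorem trace_superoperator (f : Matrix n n ℂ →ₗ[ℂ] Matrix n n ℂ) :
    LinearMap.trace ℂ (Matrix n n ℂ) f = ∑ i, ∑ j, f (single i j 1) i j := by
  rw [LinearMap.trace_eq_matrix_trace ℂ (stdBasis ℂ n n), trace, Fintype.sum_prod_type]
  simp only [diag, LinearMap.toMatrix_apply, stdBasis_eq_single]
  simp [stdBasis]

end Matrices

section SquareRoot

section FunctionalCalculus

open scoped Matrix.Norms.L2Operator MatrixOrder

theorem sqrtOp_eq_sqrt {A : Op d} (hA : A.PosSemidef) : sqrtOp A = CFC.sqrt A := by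
  rw [sqrtOp, CFC.sqrt_eq_real_sqrt A hA.nonneg, cfcₙ_eq_cfc]

theorem sqrtOp_eq_of_mul_self {A B : Op d} (hB : B.PosSemidef) (h : B * B = A) :
    sqrtOp A = B := by
  have hA : A.PosSemidef := by
    simpa only [hB.isHermitian.eq, h] using posSemidef_conjTranspose_mul_self B
  rw [sqrtOp_eq_sqrt hA, CFC.sqrt_unique h hB.nonneg]

theorem posSemidef_sqrtOp (A : Op d) : (sqrtOp A).PosSemidef :=
  nonneg_iff_posSemidef.1 (cfc_nonneg fun x _ => Real.sqrt_nonneg x)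

theorem sqrtOp_mul_self {A : Op d} (hA : A.PosSemidef) : sqrtOp A * sqrtOp A = A := by
  rw [sqrtOp_eq_sqrt hA, CFC.sqrt_mul_sqrt_self A hA.nonneg]

theorem continuousOn_sqrtOp : ContinuousOn (sqrtOp : Op d → Op d) {A | A.PosSemidef} := by
  simpa only [nonneg_iff_posSemidef] using
    (CFC.continuousOn_sqrt (A := Op d)).congr fun A hA =>
      sqrtOp_eq_sqrt (nonneg_iff_posSemidef.1 hA)

end FunctionalCalculus

theorem isHermitian_sqrtOp (A : Op d) : (sqrtOp A)ᴴ = sqrtOp A :=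
  (posSemidef_sqrtOp A).isHermitian

theorem sqrtOp_conj (V : UGroup d) {A : Op d} (hA : A.PosSemidef) :
    sqrtOp (V.1 * A * V.1ᴴ) = V.1 * sqrtOp A * V.1ᴴ :=
  sqrtOp_eq_of_mul_self ((posSemidef_sqrtOp A).mul_mul_conjTranspose_same _) <| by
    rw [conj_mul_conj, sqrtOp_mul_self hA]

theorem sqrtOp_diagOp {l : Fin d → ℝ} (hl : ∀ i, 0 ≤ l i) :
    sqrtOp (diagOp l) = diagOp fun i => √(l i) :=
  sqrtOp_eq_of_mul_self (posSemidef_diagOp fun _ => Real.sqrt_nonneg _) <| by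
    rw [diagOp_mul_diagOp]
    exact congrArg diagOp (funext fun i => Real.mul_self_sqrt (hl i))

theorem sqrtOp_smul {c : ℝ} (hc : 0 ≤ c) {A : Op d} (hA : A.PosSemidef) :
    sqrtOp ((c : ℂ) • A) = (√c : ℂ) • sqrtOp A :=
  sqrtOp_eq_of_mul_self
    ((posSemidef_sqrtOp A).smul (by exact_mod_cast Real.sqrt_nonneg c)) <| by
    rw [smul_mul_smul_comm, sqrtOp_mul_self hA, ← Complex.ofReal_mul, Real.mul_self_sqrt hc]

theorem measurable_comp_of_continuousOn {X : Type*} [MeasurableSpace X] {F : X → Op d}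
    {S : Set (Op d)} {g : Op d → ℂ} (hg : ContinuousOn g S)
    (hF : ∀ i j, Measurable fun x => F x i j) (hS : ∀ x, F x ∈ S) :
    Measurable fun x => g (F x) := by
  -- `Matrix` carries no measurable structure, so the composition is formed on `Fin d → Fin d → ℂ`.
  let F' : X → Fin d → Fin d → ℂ := F
  let S' : Set (Fin d → Fin d → ℂ) := S
  let g' : (Fin d → Fin d → ℂ) → ℂ := g
  have hF' : Measurable F' := measurable_pi_iff.2 fun i => measurable_pi_iff.2 (hF i)
  have hg' : Continuous (S'.domRestrict g') := continuousOn_iff_continuous_domRestrict.1 hg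
  exact hg'.measurable.comp (hF'.subtype_mk (h := hS))

theorem measurable_sqrtOp {X : Type*} [MeasurableSpace X] {F : X → Op d}
    (hF : ∀ i j, Measurable fun x => F x i j) (hp : ∀ x, (F x).PosSemidef) (i j : Fin d) :
    Measurable fun x => sqrtOp (F x) i j :=
  measurable_comp_of_continuousOn (g := fun A => sqrtOp A i j)
    ((continuous_id.matrix_elem i j).comp_continuousOn continuousOn_sqrtOp) hF hp

end SquareRoot

section Haar

instance isProbabilityMeasure_haarU (d : ℕ) : IsProbabilityMeasure (haarU d) :=
  ⟨by simpa [haarU] using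
    Measure.haarMeasure_self (K₀ := (⊤ : TopologicalSpace.PositiveCompacts (UGroup d)))⟩

instance isMulLeftInvariant_haarU (d : ℕ) : (haarU d).IsMulLeftInvariant :=
  Measure.isMulLeftInvariant_haarMeasure _

theorem measurable_unitary_apply (i j : Fin d) : Measurable fun U : UGroup d => U.1 i j :=
  (continuous_subtype_val.matrix_elem i j).measurable

variable [NeZero d]

theorem continuous_mulVec_single :
    Continuous fun U : UGroup d => U.1 *ᵥ (Pi.single 0 1 : Fin d → ℂ) :=
  Continuous.matrix_mulVec continuous_subtype_val continuous_const

instance isProbabilityMeasure_uniformEnsemble : IsProbabilityMeasure (uniformEnsemble d) :=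
  Measure.isProbabilityMeasure_map continuous_mulVec_single.measurable.aemeasurable

theorem ae_unit : ∀ᵐ ψ ∂(uniformEnsemble d), star ψ ⬝ᵥ ψ = 1 := by
  rw [uniformEnsemble, ae_map_iff continuous_mulVec_single.measurable.aemeasurable
    (isClosed_eq (by fun_prop) continuous_const).measurableSet]
  refine .of_forall fun U => ?_
  rw [star_mulVec, ← dotProduct_mulVec, mulVec_mulVec, conjTranspose_mul_coe, one_mulVec]
  simp

theorem measurePreserving_mulVec (W : UGroup d) :
    MeasurePreserving (fun ψ => W.1 *ᵥ ψ) (uniformEnsemble d) (uniformEnsemble d) := by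
  have hW : Measurable fun ψ : Fin d → ℂ => W.1 *ᵥ ψ :=
    (Continuous.matrix_mulVec continuous_const continuous_id).measurable
  refine ⟨hW, ?_⟩
  conv_rhs => rw [uniformEnsemble, ← map_mul_left_eq_self (haarU d) W]
  rw [uniformEnsemble, Measure.map_map hW continuous_mulVec_single.measurable,
    Measure.map_map continuous_mulVec_single.measurable (measurable_const_mul W)]
  congr 1
  ext U : 1
  simp only [Function.comp_apply, mulVec_mulVec, Submonoid.coe_mul]

theorem integral_mulVec_uniformEnsemble {E : Type*} [NormedAddCommGroup E] [NormedSpace ℝ E]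
    (W : UGroup d) (f : (Fin d → ℂ) → E) :
    ∫ ψ, f (W.1 *ᵥ ψ) ∂(uniformEnsemble d) = ∫ ψ, f ψ ∂(uniformEnsemble d) :=
  (measurePreserving_mulVec W).integral_comp
    (UnitaryGroup.toLinearEquiv W).toContinuousLinearEquiv.toHomeomorph.measurableEmbedding f

theorem integrable_uniformEnsemble_of_continuous {E : Type*} [NormedAddCommGroup E]
    [SecondCountableTopology E] {f : (Fin d → ℂ) → E} (hf : Continuous f) :
    Integrable f (uniformEnsemble d) := by
  borelize E
  rw [uniformEnsemble, integrable_map_measure hf.stronglyMeasurable.aestronglyMeasurable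
    continuous_mulVec_single.measurable.aemeasurable]
  exact (hf.comp continuous_mulVec_single).integrable_of_hasCompactSupport
    (HasCompactSupport.of_compactSpace _)

end Haar

section OpIntegral

variable {X : Type*} [MeasurableSpace X] {ν : Measure X} {G H : X → Op d}

theorem integrable_mul_mul (hG : ∀ i j, Integrable (fun x => G x i j) ν) (A B : Op d)
    (i j : Fin d) : Integrable (fun x => (A * G x * B) i j) ν := by
  simp only [mul_apply]
  exact integrable_finsetSum _ fun k _ => (integrable_finsetSum _ fun l _ =>
    (hG l k).const_mul _).mul_const _

theorem opIntegral_mul_mul (hG : ∀ i j, Integrable (fun x => G x i j) ν) (A B : Op d) :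
    opIntegral ν (fun x => A * G x * B) = A * opIntegral ν G * B := by
  have hA (i k : Fin d) : Integrable (fun x => ∑ l, A i l * G x l k) ν :=
    integrable_finsetSum _ fun l _ => (hG l k).const_mul _
  ext i j
  simp only [opIntegral, of_apply, mul_apply]
  rw [integral_finsetSum _ fun k _ => (hA i k).mul_const _]
  refine Finset.sum_congr rfl fun k _ => ?_
  rw [integral_mul_const, integral_finsetSum _ fun l _ => (hG l k).const_mul _]
  simp only [integral_const_mul]

theorem trace_opIntegral (hG : ∀ i, Integrable (fun x => G x i i) ν) :
    (opIntegral ν G).trace = ∫ x, (G x).trace ∂ν :=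
  (integral_finsetSum _ fun i _ => hG i).symm

theorem opIntegral_add (hG : ∀ i j, Integrable (fun x => G x i j) ν)
    (hH : ∀ i j, Integrable (fun x => H x i j) ν) :
    opIntegral ν (fun x => G x + H x) = opIntegral ν G + opIntegral ν H := by
  ext i j
  exact integral_add (hG i j) (hH i j)

theorem opIntegral_smul (c : ℂ) (G : X → Op d) :
    opIntegral ν (fun x => c • G x) = c • opIntegral ν G := by
  ext i j
  exact integral_const_mul c _

end OpIntegral

section Covariance

theorem isUnitarilyCovariant_iff {𝒜 : Op d → Op d} :
    IsUnitarilyCovariant 𝒜 ↔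
      ∀ (W : UGroup d) (ρ : Op d), 𝒜 (W.1 * ρ * W.1ᴴ) = W.1 * 𝒜 ρ * W.1ᴴ := by
  have key (W : UGroup d) (A B : Op d) : W.1ᴴ * A * W.1 = B ↔ A = W.1 * B * W.1ᴴ := by
    constructor
    · rintro rfl
      simp only [Matrix.mul_assoc, coe_mul_conjTranspose, Matrix.mul_one]
      rw [← Matrix.mul_assoc, coe_mul_conjTranspose, Matrix.one_mul]
    · rintro rfl
      simp only [Matrix.mul_assoc, conjTranspose_mul_coe, Matrix.mul_one]
      rw [← Matrix.mul_assoc, conjTranspose_mul_coe, Matrix.one_mul]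
  exact forall₂_congr fun W ρ => key W _ _

theorem isUnitarilyCovariant_depolarizing (p : ℝ) :
    IsUnitarilyCovariant (depolarizing p : Op d → Op d) :=
  isUnitarilyCovariant_iff.2 fun W ρ => by
    simp [depolarizing, trace_conj, Matrix.mul_add, Matrix.add_mul, coe_mul_conjTranspose]

/-- Covariant maps form the span of the identity and `ρ ↦ (tr ρ) I`, on which the trace of the
output and the superoperator trace separate points, unless `d = 1`. -/
theorem coe_eq_depolarizing [NeZero d] {L : Op d →ₗ[ℂ] Op d} (hL : IsUnitarilyCovariant L)
    (htr : ∀ ρ, (L ρ).trace = ρ.trace) {p : ℝ}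
    (hp : d ≠ 1 → LinearMap.trace ℂ (Op d) L = d ^ 2 - p * (d ^ 2 - 1)) :
    ⇑L = depolarizing p := by
  have hd : (d : ℂ) ≠ 0 := NeZero.ne _
  obtain ⟨a, b, hab⟩ := exists_eq_of_covariant L (isUnitarilyCovariant_iff.1 hL)
  have happ (ρ : Op d) : L ρ = a • ρ + (b * ρ.trace) • (1 : Op d) := by simp [hab]
  have htr_one : a + b * d = 1 := by
    have h := htr 1
    simp only [happ, trace_add, trace_smul, trace_one, Fintype.card_fin, smul_eq_mul] at h
    exact mul_right_cancel₀ hd (by linear_combination h)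
  have hb : b = (1 - a) / d := by
    field_simp
    linear_combination htr_one
  have hdiff (ρ : Op d) :
      L ρ - depolarizing p ρ = (a - (1 - p)) • (ρ - (ρ.trace / d) • (1 : Op d)) := by
    rw [happ, depolarizing, hb]
    push_cast
    module
  ext1 ρ
  rw [← sub_eq_zero, hdiff]
  by_cases hd1 : d = 1
  · subst hd1
    refine smul_eq_zero_of_right _ ?_
    ext i j
    simp [Subsingleton.elim i 0, Subsingleton.elim j 0, trace]
  have hd2 : (d : ℂ) ^ 2 - 1 ≠ 0 := by
    rw [sub_ne_zero]
    exact_mod_cast fun h : d ^ 2 = 1 => hd1 (by simpa using h)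
  have ha : (a - (1 - p)) * ((d : ℂ) ^ 2 - 1) = 0 := by
    have hp := hp hd1
    simp only [hab, map_add, map_smul, LinearMap.trace_id, LinearMap.trace_smulRight,
      LinearMap.smul_apply, traceLinearMap_apply, trace_one, Module.finrank_matrix,
      Module.finrank_self, Fintype.card_fin, smul_eq_mul, mul_one, Nat.cast_mul] at hp
    linear_combination hp - htr_one
  rw [(mul_eq_zero.1 ha).resolve_right hd2, zero_smul]

end Covariance

section Moments

theorem ketbra_mulVec (W : Op d) (ψ : Fin d → ℂ) : ketbra (W *ᵥ ψ) = W * ketbra ψ * Wᴴ := by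
  rw [ketbra, ketbra, star_mulVec, mul_vecMulVec, vecMulVec_mul]

theorem continuous_ketbra : Continuous (ketbra : (Fin d → ℂ) → Op d) :=
  Continuous.matrix_vecMulVec continuous_id (by fun_prop)

theorem trace_mul_ketbra (A : Op d) (ψ : Fin d → ℂ) :
    (A * ketbra ψ).trace = star ψ ⬝ᵥ A *ᵥ ψ := by
  rw [ketbra, mul_vecMulVec, trace_vecMulVec, dotProduct_comm]

theorem trace_ketbra {ψ : Fin d → ℂ} (hψ : star ψ ⬝ᵥ ψ = 1) : (ketbra ψ).trace = 1 := by
  rw [ketbra, trace_vecMulVec, dotProduct_comm, hψ]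

theorem trace_conj_mul_ketbra (W : UGroup d) (A : Op d) (ψ : Fin d → ℂ) :
    (W.1 * A * W.1ᴴ * ketbra (W.1 *ᵥ ψ)).trace = (A * ketbra ψ).trace := by
  rw [ketbra_mulVec, conj_mul_conj, trace_conj]

theorem continuous_trace_mul_ketbra (A : Op d) : Continuous fun ψ => (A * ketbra ψ).trace :=
  (continuous_const.matrix_mul continuous_ketbra).matrix_trace

theorem continuous_trace_smul_ketbra (A : Op d) :
    Continuous fun ψ => (A * ketbra ψ).trace • ketbra ψ :=
  (continuous_trace_mul_ketbra A).smul continuous_ketbra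

variable [NeZero d]

theorem integrable_trace_smul_ketbra (A : Op d) (i j : Fin d) :
    Integrable (fun ψ => ((A * ketbra ψ).trace • ketbra ψ) i j) (uniformEnsemble d) :=
  integrable_uniformEnsemble_of_continuous ((continuous_trace_smul_ketbra A).matrix_elem i j)

/-- The second moment map `A ↦ ∫ ⟨ψ|A|ψ⟩ |ψ⟩⟨ψ| dΩ(ψ)`. -/
noncomputable def momentMap : Op d →ₗ[ℂ] Op d where
  toFun A := opIntegral (uniformEnsemble d) fun ψ => (A * ketbra ψ).trace • ketbra ψ
  map_add' A B := by
    rw [← opIntegral_add (integrable_trace_smul_ketbra A) (integrable_trace_smul_ketbra B)]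
    simp only [Matrix.add_mul, trace_add, add_smul]
  map_smul' c A := by
    rw [RingHom.id_apply, ← opIntegral_smul]
    simp only [Matrix.smul_mul, trace_smul, smul_smul, smul_eq_mul]

theorem momentMap_apply (A : Op d) :
    momentMap A =
      opIntegral (uniformEnsemble d) fun ψ => (A * ketbra ψ).trace • ketbra ψ := rfl

theorem momentMap_conj (W : UGroup d) (A : Op d) :
    momentMap (W.1 * A * W.1ᴴ) = W.1 * momentMap A * W.1ᴴ := by
  rw [momentMap_apply, momentMap_apply, ← opIntegral_mul_mul (integrable_trace_smul_ketbra A)]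
  ext i j
  simp only [opIntegral, of_apply]
  rw [← integral_mulVec_uniformEnsemble W]
  simp only [trace_conj_mul_ketbra]
  simp only [ketbra_mulVec, Matrix.mul_smul, Matrix.smul_mul]

theorem trace_mul_momentMap (A B : Op d) :
    (B * momentMap A).trace =
      ∫ ψ, (A * ketbra ψ).trace * (B * ketbra ψ).trace ∂(uniformEnsemble d) := by
  have h := opIntegral_mul_mul (integrable_trace_smul_ketbra A) B 1
  simp only [Matrix.mul_one] at h
  rw [momentMap_apply, ← h, trace_opIntegral fun i => by
    simpa only [Matrix.mul_one] using integrable_mul_mul (integrable_trace_smul_ketbra A) B 1 i i]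
  simp only [Matrix.mul_smul, trace_smul, smul_eq_mul]

theorem trace_momentMap_eq_integral (A : Op d) :
    (momentMap A).trace = ∫ ψ, (A * ketbra ψ).trace ∂(uniformEnsemble d) := by
  rw [← Matrix.one_mul (momentMap A), trace_mul_momentMap]
  refine integral_congr_ae ?_
  filter_upwards [ae_unit] with ψ hψ
  rw [Matrix.one_mul, trace_ketbra hψ, mul_one]

theorem trace_momentMap (A : Op d) : (momentMap A).trace = A.trace / d := by
  have hone : (momentMap (1 : Op d)).trace = 1 := by
    rw [trace_momentMap_eq_integral, integral_congr_ae (g := fun _ => 1)]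
    · simp
    · filter_upwards [ae_unit] with ψ hψ
      rw [Matrix.one_mul, trace_ketbra hψ]
  have h := card_smul_eq_trace_smul_of_conj_invariant
    (traceLinearMap (Fin d) ℂ ℂ ∘ₗ momentMap) (fun W A => by
      simp only [LinearMap.comp_apply, momentMap_conj, traceLinearMap_apply, trace_conj]) A
  simp only [LinearMap.comp_apply, traceLinearMap_apply, hone, Fintype.card_fin, smul_eq_mul,
    mul_one] at h
  exact eq_div_of_mul_eq (NeZero.ne _) (by rw [mul_comm, h])

theorem integral_trace_mul_ketbra (A : Op d) :
    ∫ ψ, (A * ketbra ψ).trace ∂(uniformEnsemble d) = A.trace / d := by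
  rw [← trace_momentMap_eq_integral, trace_momentMap]

theorem momentMap_single_apply (i j : Fin d) :
    momentMap (single i j 1) i j =
      ∫ ψ, (star ψ i * ψ i) * (star ψ j * ψ j) ∂(uniformEnsemble d) := by
  refine integral_congr_ae (.of_forall fun ψ => ?_)
  simp only [Matrix.smul_apply, smul_eq_mul, trace_single_mul, ketbra, vecMulVec_apply, one_mul]
  ring

theorem superoperatorTrace_momentMap : LinearMap.trace ℂ (Op d) momentMap = 1 := by
  have hint (i j : Fin d) :
      Integrable (fun ψ : Fin d → ℂ => (star ψ i * ψ i) * (star ψ j * ψ j))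
        (uniformEnsemble d) :=
    integrable_uniformEnsemble_of_continuous (by fun_prop)
  have hunit : ∀ᵐ ψ : Fin d → ℂ ∂(uniformEnsemble d),
      ∑ i, ∑ j, (star ψ i * ψ i) * (star ψ j * ψ j) = 1 := by
    filter_upwards [ae_unit] with ψ hψ
    rw [← Finset.sum_mul_sum, ← dotProduct, hψ, one_mul]
  simp only [trace_superoperator, momentMap_single_apply, ← integral_finsetSum _
    fun j _ => hint _ j]
  rw [← integral_finsetSum _ fun i _ => integrable_finsetSum _ fun j _ => hint i j,
    integral_congr_ae hunit]
  simp

theorem momentMap_eq (A : Op d) :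
    momentMap A = ((d * (d + 1) : ℂ)⁻¹) • (A + A.trace • (1 : Op d)) := by
  have hd : (d : ℂ) ≠ 0 := NeZero.ne _
  have hd1 : (d : ℂ) + 1 ≠ 0 := Nat.cast_add_one_ne_zero d
  have h := congrFun (coe_eq_depolarizing (L := (d : ℂ) • momentMap (d := d))
    (p := d / (d + 1))
    (isUnitarilyCovariant_iff.2 fun W ρ => by simp [momentMap_conj])
    (fun ρ => by simp [trace_momentMap, mul_div_cancel₀ _ hd])
    (fun _ => by
      simp only [map_smul, superoperatorTrace_momentMap]
      push_cast
      field_simp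
      ring)) A
  rw [LinearMap.smul_apply] at h
  rw [← inv_smul_smul₀ hd (momentMap A), h, depolarizing]
  push_cast
  match_scalars <;> field_simp
  ring

theorem integral_trace_mul_trace (A B : Op d) :
    ∫ ψ, (A * ketbra ψ).trace * (B * ketbra ψ).trace ∂(uniformEnsemble d) =
      ((A * B).trace + A.trace * B.trace) / (d * (d + 1)) := by
  rw [← trace_mul_momentMap, momentMap_eq]
  simp only [Matrix.mul_smul, Matrix.mul_add, Matrix.mul_one, trace_smul, trace_add, smul_eq_mul]
  rw [trace_mul_comm B A]
  ring

end Moments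

section Fidelity

theorem ofReal_re_trace {A : Op d} (hA : A.PosSemidef) : (A.trace.re : ℂ) = A.trace :=
  (Complex.eq_re_of_ofReal_le (r := 0) (by simpa using hA.trace_nonneg)).symm

theorem re_trace_nonneg {A : Op d} (hA : A.PosSemidef) : 0 ≤ A.trace.re :=
  (Complex.nonneg_iff.1 hA.trace_nonneg).1

theorem condProb_nonneg {A : Op d} (hA : A.PosSemidef) (ψ : Fin d → ℂ) : 0 ≤ condProb A ψ := by
  rw [condProb, trace_mul_ketbra]
  exact (Complex.nonneg_iff.1 (hA.dotProduct_mulVec_nonneg ψ)).1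

theorem ofReal_condProb {A : Op d} (hA : A.PosSemidef) (ψ : Fin d → ℂ) :
    (condProb A ψ : ℂ) = (A * ketbra ψ).trace := by
  have h := hA.dotProduct_mulVec_nonneg ψ
  rw [← trace_mul_ketbra] at h
  exact (Complex.eq_re_of_ofReal_le (r := 0) (by simpa using h)).symm

theorem ketbra_mul_mul_ketbra (ψ : Fin d → ℂ) (B : Op d) :
    ketbra ψ * B * ketbra ψ = (B * ketbra ψ).trace • ketbra ψ := by
  rw [trace_mul_ketbra]
  simp only [ketbra]
  rw [Matrix.mul_assoc, mul_vecMulVec, vecMulVec_mul_vecMulVec, vecMulVec_smul]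

theorem ketbra_mul_self {ψ : Fin d → ℂ} (hψ : star ψ ⬝ᵥ ψ = 1) :
    ketbra ψ * ketbra ψ = ketbra ψ := by
  have h := ketbra_mul_mul_ketbra ψ 1
  rwa [Matrix.mul_one, Matrix.one_mul, trace_ketbra hψ, one_smul] at h

theorem posSemidef_ketbra (ψ : Fin d → ℂ) : (ketbra ψ).PosSemidef :=
  posSemidef_vecMulVec_self_star ψ

theorem condProb_le_trace {A : Op d} (hA : A.PosSemidef) {ψ : Fin d → ℂ}
    (hψ : star ψ ⬝ᵥ ψ = 1) : condProb A ψ ≤ A.trace.re := by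
  have hherm : (1 - ketbra ψ)ᴴ = 1 - ketbra ψ := by
    rw [conjTranspose_sub, conjTranspose_one, (posSemidef_ketbra ψ).isHermitian.eq]
  have hidem : (1 - ketbra ψ) * (1 - ketbra ψ) = 1 - ketbra ψ :=
    (IsIdempotentElem.one_sub (ketbra_mul_self hψ)).eq
  have hcompress := re_trace_nonneg (hA.conjTranspose_mul_mul_same (1 - ketbra ψ))
  rwa [hherm, Matrix.mul_assoc, trace_mul_comm, Matrix.mul_assoc, hidem, Matrix.mul_sub,
    Matrix.mul_one, trace_sub, Complex.sub_re, sub_nonneg] at hcompress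

theorem fidelity_ketbra {ψ : Fin d → ℂ} (hψ : star ψ ⬝ᵥ ψ = 1) {σ : Op d} (hσ : σ.PosSemidef) :
    fidelity (ketbra ψ) σ = condProb σ ψ := by
  have hsqrt : sqrtOp (ketbra ψ) = ketbra ψ :=
    sqrtOp_eq_of_mul_self (posSemidef_ketbra ψ) (ketbra_mul_self hψ)
  have hprob := condProb_nonneg hσ ψ
  rw [fidelity, hsqrt, ketbra_mul_mul_ketbra, ← ofReal_condProb hσ,
    sqrtOp_smul hprob (posSemidef_ketbra ψ), hsqrt, trace_smul, trace_ketbra hψ, smul_eq_mul,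
    mul_one, Complex.ofReal_re, Real.sq_sqrt hprob]

end Fidelity

section TraceNorm

theorem re_conjTranspose_mul_self_apply {m n : Type*} [Fintype m] (A : Matrix m n ℂ) (j : n) :
    ((Aᴴ * A) j j).re = ∑ k, ‖A k j‖ ^ 2 := by
  rw [mul_apply, Complex.re_sum]
  refine Finset.sum_congr rfl fun k _ => ?_
  rw [conjTranspose_apply, Complex.star_def, Complex.conj_mul', ← Complex.ofReal_pow,
    Complex.ofReal_re]

open scoped Matrix.Norms.L2Operator MatrixOrder in
theorem norm_apply_le_trace {n : Type*} [Fintype n] {A : Matrix n n ℂ} (hA : A.PosSemidef)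
    (i j : n) : ‖A i j‖ ≤ A.trace.re := by
  classical
  obtain ⟨B, rfl⟩ := CStarAlgebra.nonneg_iff_eq_star_mul_self.1 hA.nonneg
  rw [star_eq_conjTranspose] at hA ⊢
  have hdiag (j : n) : ∑ k, ‖B k j‖ ^ 2 ≤ (Bᴴ * B).trace.re := by
    rw [← re_conjTranspose_mul_self_apply, trace, Complex.re_sum]
    exact Finset.single_le_sum (f := fun k => ((Bᴴ * B) k k).re)
      (fun k _ => (Complex.nonneg_iff.1 hA.diag_nonneg).1) (Finset.mem_univ j)
  calc ‖(Bᴴ * B) i j‖ ≤ ∑ k, ‖B k i‖ * ‖B k j‖ :=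
        norm_sum_le_of_le _ fun k _ => by simp
    _ ≤ ∑ k, (‖B k i‖ ^ 2 + ‖B k j‖ ^ 2) / 2 :=
        Finset.sum_le_sum fun k _ => by linarith [two_mul_le_add_sq ‖B k i‖ ‖B k j‖]
    _ = (∑ k, ‖B k i‖ ^ 2 + ∑ k, ‖B k j‖ ^ 2) / 2 := by
        rw [← Finset.sum_div, Finset.sum_add_distrib]
    _ ≤ (Bᴴ * B).trace.re := by linarith [hdiag i, hdiag j]

/-- Minkowski's inequality in `ℓ²(ι)`, applied to the sequences of `j`-th diagonal entries. -/
theorem sum_norm_trace_sq_le {ι n : Type*} [Fintype ι] [Fintype n] (B : ι → Matrix n n ℂ) :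
    ∑ i, ‖(B i).trace‖ ^ 2 ≤ (∑ j, √((∑ i, (B i)ᴴ * B i) j j).re) ^ 2 := by
  let v (j : n) : EuclideanSpace ℂ ι := WithLp.toLp 2 fun i => B i j j
  have hv (j : n) : ‖v j‖ ≤ √((∑ i, (B i)ᴴ * B i) j j).re := by
    rw [EuclideanSpace.norm_eq, Matrix.sum_apply, Complex.re_sum]
    refine Real.sqrt_le_sqrt (Finset.sum_le_sum fun i _ => ?_)
    rw [re_conjTranspose_mul_self_apply]
    exact Finset.single_le_sum (f := fun k => ‖B i k j‖ ^ 2) (fun k _ => sq_nonneg _)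
      (Finset.mem_univ j)
  calc ∑ i, ‖(B i).trace‖ ^ 2
      = ‖∑ j, v j‖ ^ 2 := by simp [EuclideanSpace.norm_sq_eq, v, trace]
    _ ≤ (∑ j, √((∑ i, (B i)ᴴ * B i) j j).re) ^ 2 := by
        gcongr
        exact norm_sum_le_of_le _ fun j _ => hv j

theorem re_trace_sqrtOp_conj_diagOp (V : UGroup d) {l : Fin d → ℝ} (hl : ∀ i, 0 ≤ l i) :
    (sqrtOp (V.1 * diagOp l * V.1ᴴ)).trace.re = ∑ i, √(l i) := by
  rw [sqrtOp_conj V (posSemidef_diagOp hl), trace_conj, sqrtOp_diagOp hl, trace_diagOp,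
    Complex.ofReal_re]

theorem sum_norm_trace_sq_le_trace_sqrtOp_sq {ι : Type*} [Fintype ι] (A : ι → Op d) :
    ∑ i, ‖(A i).trace‖ ^ 2 ≤ (sqrtOp (∑ i, (A i)ᴴ * A i)).trace.re ^ 2 := by
  have hpos : (∑ i, (A i)ᴴ * A i).PosSemidef :=
    posSemidef_sum _ fun i _ => posSemidef_conjTranspose_mul_self _
  obtain ⟨V, l, hl, hV⟩ := exists_diagonalization hpos
  have hdiag : ∑ i, (V⁻¹.1 * A i * V⁻¹.1ᴴ)ᴴ * (V⁻¹.1 * A i * V⁻¹.1ᴴ) = diagOp l := by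
    have hconj (i : ι) : (V⁻¹.1 * A i * V⁻¹.1ᴴ)ᴴ * (V⁻¹.1 * A i * V⁻¹.1ᴴ) =
        V⁻¹.1 * ((A i)ᴴ * A i) * V⁻¹.1ᴴ := by
      rw [← conj_mul_conj]
      simp only [conjTranspose_mul, conjTranspose_conjTranspose, Matrix.mul_assoc]
    simp only [hconj]
    rw [← Finset.sum_mul, ← Finset.mul_sum, hV, conj_conj, inv_mul_cancel]
    simp
  have hmink := sum_norm_trace_sq_le fun i => V⁻¹.1 * A i * V⁻¹.1ᴴ
  rw [hdiag] at hmink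
  rw [hV, re_trace_sqrtOp_conj_diagOp V hl]
  simpa only [trace_conj, diagOp, diagonal_apply_eq, Complex.ofReal_re] using hmink

end TraceNorm

section Kraus

/-- The linear map `ρ ↦ ∑ i, A i ρ (A i)†` with Kraus operators `A i`. -/
noncomputable def krausMap {ι : Type*} [Fintype ι] (A : ι → Op d) : Op d →ₗ[ℂ] Op d :=
  ∑ i, LinearMap.mulLeftRight ℂ (A i, (A i)ᴴ)

/-- The largest average fidelity to the input among the operations compatible with an effect. -/
noncomputable def optimalFidelity (E : Op d) : ℝ :=
  (E.trace.re + (sqrtOp E).trace.re ^ 2) / (d * (d + 1))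

variable {ι : Type*} [Fintype ι] {A : ι → Op d} {𝒜 : Op d → Op d} {E : Op d}

theorem krausMap_apply (A : ι → Op d) (ρ : Op d) : krausMap A ρ = ∑ i, A i * ρ * (A i)ᴴ := by
  simp [krausMap]

theorem IsKrausDecomposition.eq_krausMap (h : IsKrausDecomposition A 𝒜) : 𝒜 = krausMap A :=
  funext fun ρ => (h ρ).trans (krausMap_apply A ρ).symm

theorem posSemidef_krausMap (A : ι → Op d) {ρ : Op d} (hρ : ρ.PosSemidef) :
    (krausMap A ρ).PosSemidef := by
  rw [krausMap_apply]
  exact posSemidef_sum _ fun i _ => hρ.mul_mul_conjTranspose_same _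

theorem trace_krausMap (A : ι → Op d) (ρ : Op d) :
    (krausMap A ρ).trace = ((∑ i, (A i)ᴴ * A i) * ρ).trace := by
  rw [krausMap_apply, Finset.sum_mul, trace_sum, trace_sum]
  exact Finset.sum_congr rfl fun i _ => by rw [Matrix.trace_mul_cycle]

theorem superoperatorTrace_krausMap (A : ι → Op d) :
    LinearMap.trace ℂ (Op d) (krausMap A) = ∑ i, (‖(A i).trace‖ : ℂ) ^ 2 := by
  simp only [krausMap, map_sum]
  refine Finset.sum_congr rfl fun i _ => ?_
  have hentry (j k : Fin d) :
      (A i * single j k (1 : ℂ) * (A i)ᴴ) j k = A i j j * star (A i k k) := by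
    simp [mul_apply, single_apply, ite_and]
  rw [trace_superoperator, ← Complex.mul_conj']
  simp only [LinearMap.mulLeftRight_apply, hentry, ← Finset.sum_mul_sum, trace, diag, map_sum,
    Complex.star_def]

theorem ofReal_condProb_krausMap (A : ι → Op d) (ψ : Fin d → ℂ) :
    (condProb (krausMap A (ketbra ψ)) ψ : ℂ) =
      ∑ i, (A i * ketbra ψ).trace * ((A i)ᴴ * ketbra ψ).trace := by
  rw [ofReal_condProb (posSemidef_krausMap A (posSemidef_ketbra ψ)), krausMap_apply,
    Finset.sum_mul, trace_sum]
  refine Finset.sum_congr rfl fun i _ => ?_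
  rw [Matrix.mul_assoc, Matrix.mul_assoc, ← Matrix.mul_assoc (ketbra ψ), ketbra_mul_mul_ketbra,
    Matrix.mul_smul, trace_smul, smul_eq_mul, mul_comm]

theorem integral_condProb_krausMap [NeZero d] (A : ι → Op d) :
    ∫ ψ, condProb (krausMap A (ketbra ψ)) ψ ∂(uniformEnsemble d) =
      ((∑ i, (A i)ᴴ * A i).trace.re + ∑ i, ‖(A i).trace‖ ^ 2) / (d * (d + 1)) := by
  have hint (i : ι) : Integrable (fun ψ => (A i * ketbra ψ).trace * ((A i)ᴴ * ketbra ψ).trace)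
      (uniformEnsemble d) := integrable_uniformEnsemble_of_continuous
    ((continuous_trace_mul_ketbra (A i)).mul (continuous_trace_mul_ketbra (A i)ᴴ))
  have hpos : (∑ i, (A i)ᴴ * A i).PosSemidef :=
    posSemidef_sum _ fun i _ => posSemidef_conjTranspose_mul_self _
  apply Complex.ofReal_injective
  rw [← integral_complex_ofReal]
  simp only [ofReal_condProb_krausMap]
  rw [integral_finsetSum _ fun i _ => hint i]
  simp only [integral_trace_mul_trace]
  push_cast
  rw [ofReal_re_trace hpos, trace_sum, ← Finset.sum_div, Finset.sum_add_distrib]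
  congr 2
  · exact Finset.sum_congr rfl fun i _ => trace_mul_comm _ _
  · exact Finset.sum_congr rfl fun i _ => by
      rw [trace_conjTranspose, Complex.star_def, Complex.mul_conj']

theorem integral_condProb_le_optimalFidelity [NeZero d] (h : IsCompatible E 𝒜) :
    ∫ ψ, condProb (𝒜 (ketbra ψ)) ψ ∂(uniformEnsemble d) ≤ optimalFidelity E := by
  obtain ⟨r, A, hA, rfl⟩ := h
  rw [hA.eq_krausMap, integral_condProb_krausMap, optimalFidelity]
  gcongr
  exact sum_norm_trace_sq_le_trace_sqrtOp_sq A

theorem krausMap_sqrtOp (E ρ : Op d) :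
    krausMap (fun _ : Fin 1 => sqrtOp E) ρ = sqrtOp E * ρ * sqrtOp E := by
  simp [krausMap_apply, isHermitian_sqrtOp]

theorem isCompatible_sqrtOp (hE : E.PosSemidef) :
    IsCompatible E fun ρ => sqrtOp E * ρ * sqrtOp E :=
  ⟨1, fun _ => sqrtOp E, fun ρ => (krausMap_sqrtOp E ρ).symm.trans (krausMap_apply _ ρ), by
    simp [isHermitian_sqrtOp, sqrtOp_mul_self hE]⟩

theorem integral_condProb_sqrtOp [NeZero d] (hE : E.PosSemidef) :
    ∫ ψ, condProb (sqrtOp E * ketbra ψ * sqrtOp E) ψ ∂(uniformEnsemble d) =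
      optimalFidelity E := by
  have hnorm : ‖(sqrtOp E).trace‖ = (sqrtOp E).trace.re :=
    (Complex.re_eq_norm.2 (posSemidef_sqrtOp E).trace_nonneg).symm
  simp only [← krausMap_sqrtOp]
  rw [integral_condProb_krausMap, optimalFidelity]
  simp [isHermitian_sqrtOp, sqrtOp_mul_self hE, hnorm]

theorem IsCompatible.apply_eq_sum (h : IsCompatible E 𝒜) (ρ : Op d) :
    𝒜 ρ = ∑ i, ∑ j, ρ i j • 𝒜 (single i j 1) := by
  obtain ⟨r, A, hA, -⟩ := h
  conv_lhs => rw [matrix_eq_sum_single ρ]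
  simp only [hA.eq_krausMap, map_sum, ← map_smul, smul_single, smul_eq_mul, mul_one]

theorem IsCompatible.isLinearMap (h : IsCompatible E 𝒜) : IsLinearMap ℂ 𝒜 := by
  obtain ⟨r, A, hA, -⟩ := h
  rw [hA.eq_krausMap]
  exact (krausMap A).isLinear

theorem IsCompatible.posSemidef (h : IsCompatible E 𝒜) {ρ : Op d} (hρ : ρ.PosSemidef) :
    (𝒜 ρ).PosSemidef := by
  obtain ⟨r, A, hA, -⟩ := h
  rw [hA.eq_krausMap]
  exact posSemidef_krausMap A hρ

theorem IsCompatible.trace_apply (h : IsCompatible E 𝒜) (ρ : Op d) :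
    (𝒜 ρ).trace = (E * ρ).trace := by
  obtain ⟨r, A, hA, rfl⟩ := h
  rw [hA.eq_krausMap, trace_krausMap]

end Kraus

section Invariance

variable {E : Op d} {c : ℝ}

theorem condProb_conj_mulVec (W : UGroup d) (E : Op d) (ψ : Fin d → ℂ) :
    condProb (W.1 * E * W.1ᴴ) (W.1 *ᵥ ψ) = condProb E ψ := by
  rw [condProb, trace_conj_mul_ketbra, condProb]

theorem condProb_smul (c : ℝ) (E : Op d) (ψ : Fin d → ℂ) :
    condProb ((c : ℂ) • E) ψ = c * condProb E ψ := by
  rw [condProb, Matrix.smul_mul, trace_smul, smul_eq_mul, Complex.re_ofReal_mul, condProb]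

theorem optimalFidelity_conj (W : UGroup d) (hE : E.PosSemidef) :
    optimalFidelity (W.1 * E * W.1ᴴ) = optimalFidelity E := by
  rw [optimalFidelity, sqrtOp_conj W hE, trace_conj, trace_conj, optimalFidelity]

theorem optimalFidelity_smul (hc : 0 ≤ c) (hE : E.PosSemidef) :
    optimalFidelity ((c : ℂ) • E) = c * optimalFidelity E := by
  rw [optimalFidelity, sqrtOp_smul hc hE, trace_smul, trace_smul, smul_eq_mul, smul_eq_mul,
    Complex.re_ofReal_mul, Complex.re_ofReal_mul, mul_pow, Real.sq_sqrt hc, optimalFidelity]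
  ring

variable [NeZero d]

/-- The information density `∫ p(x|ψ) log (p(x|ψ) / p(x)) dΩ(ψ)` of an effect. -/
noncomputable def infoDensity (E : Op d) : ℝ :=
  ∫ ψ, condProb E ψ * Real.log (condProb E ψ / meanProb E) ∂(uniformEnsemble d)

theorem meanProb_eq (E : Op d) : meanProb E = E.trace.re / d := by
  have h := integral_re (integrable_uniformEnsemble_of_continuous (continuous_trace_mul_ketbra E))
  rw [integral_trace_mul_ketbra] at h
  exact h.trans (Complex.div_natCast_re _ _)

theorem meanProb_nonneg (hE : E.PosSemidef) : 0 ≤ meanProb E :=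
  integral_nonneg fun ψ => condProb_nonneg hE ψ

theorem meanProb_conj (W : UGroup d) (E : Op d) : meanProb (W.1 * E * W.1ᴴ) = meanProb E := by
  rw [meanProb_eq, trace_conj, meanProb_eq]

theorem meanProb_smul (c : ℝ) (E : Op d) : meanProb ((c : ℂ) • E) = c * meanProb E := by
  simp only [meanProb, condProb_smul, integral_const_mul]

theorem infoDensity_conj (W : UGroup d) (E : Op d) :
    infoDensity (W.1 * E * W.1ᴴ) = infoDensity E := by
  rw [infoDensity, ← integral_mulVec_uniformEnsemble W]
  simp only [condProb_conj_mulVec, meanProb_conj, infoDensity]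

theorem infoDensity_smul (c : ℝ) (E : Op d) :
    infoDensity ((c : ℂ) • E) = c * infoDensity E := by
  rw [infoDensity, infoDensity, ← integral_const_mul]
  congr 1
  ext ψ
  rw [condProb_smul, meanProb_smul]
  rcases eq_or_ne c 0 with rfl | hc
  · simp
  · rw [mul_div_mul_left _ _ hc, mul_assoc]

end Invariance

section Densities

variable {X : Type*} [MeasurableSpace X] {ν : Measure X} {F : X → Op d} {𝒜 : X → Op d → Op d}

theorem measurable_condProb {G : X → Op d} {φ : X → Fin d → ℂ}
    (hG : ∀ i j, Measurable fun x => G x i j) (hφ : Measurable φ) :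
    Measurable fun x => condProb (G x) (φ x) := by
  have hφ_apply (i : Fin d) : Measurable fun x => φ x i := (measurable_pi_apply i).comp hφ
  simp only [condProb, trace_mul_ketbra, dotProduct, mulVec, Pi.star_apply]
  refine Complex.measurable_re.comp (Finset.measurable_sum _ fun i _ => ?_)
  exact (continuous_star.measurable.comp (hφ_apply i)).mul
    (Finset.measurable_sum _ fun j _ => (hG i j).mul (hφ_apply j))

theorem IsPOVM.integrable_trace (h : IsPOVM ν F) : Integrable (fun x => (F x).trace.re) ν :=
  (integrable_finsetSum _ fun i _ => h.integrable i i).re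

theorem IsPOVM.integral_trace (h : IsPOVM ν F) : ∫ x, (F x).trace.re ∂ν = d := by
  have htrace : Integrable (fun x => (F x).trace) ν :=
    integrable_finsetSum _ fun i _ => h.integrable i i
  have hre := integral_re htrace
  rw [← trace_opIntegral fun i => h.integrable i i, h.integral_eq_one, trace_one,
    Fintype.card_fin] at hre
  simpa using hre

theorem IsPOVM.isProcedure_sqrtDynamics (h : IsPOVM ν F) :
    IsProcedure ν F (sqrtDynamics F) where
  povm := h
  measurable ρ i j := by
    have hS := measurable_sqrtOp h.measurable h.posSemidef
    simp only [sqrtDynamics, mul_apply]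
    exact Finset.measurable_sum _ fun k _ =>
      (Finset.measurable_sum _ fun l _ => (hS i l).mul_const _).mul (hS k j)
  compatible x := isCompatible_sqrtOp (h.posSemidef x)

theorem abs_mul_log_le (t : ℝ) : |t * Real.log t| ≤ 1 + t ^ 2 := by
  rcases eq_or_ne t 0 with rfl | ht
  · simp
  have hpos := abs_pos.2 ht
  have hupper : |t| * Real.log |t| ≤ |t| * (|t| - 1) := by
    gcongr
    exact Real.log_le_sub_one_of_pos hpos
  have hlower : |t| * (1 - |t|⁻¹) ≤ |t| * Real.log |t| := by
    gcongr
    exact Real.one_sub_inv_le_log_of_pos hpos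
  rw [mul_sub, mul_inv_cancel₀ hpos.ne'] at hlower
  calc |t * Real.log t| = |(|t| * Real.log |t|)| := by
        rw [abs_mul, abs_mul, abs_abs, Real.log_abs]
    _ ≤ 1 + |t| ^ 2 := abs_le.2 ⟨by nlinarith, by nlinarith⟩
    _ = 1 + t ^ 2 := by rw [sq_abs]

variable [NeZero d]

theorem abs_condProb_mul_log_le {E : Op d} (hE : E.PosSemidef) {ψ : Fin d → ℂ}
    (hψ : star ψ ⬝ᵥ ψ = 1) :
    |condProb E ψ * Real.log (condProb E ψ / meanProb E)| ≤ (1 + (d : ℝ) ^ 2) * meanProb E := by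
  have hd : (d : ℝ) ≠ 0 := NeZero.ne _
  have hprob := condProb_nonneg hE ψ
  have hprob_le : condProb E ψ ≤ d * meanProb E := by
    rw [meanProb_eq, mul_div_cancel₀ _ hd]
    exact condProb_le_trace hE hψ
  rcases (meanProb_nonneg hE).eq_or_lt with hmean | hmean
  · have hzero : condProb E ψ = 0 := le_antisymm (by simpa [← hmean] using hprob_le) hprob
    simp [hzero, ← hmean]
  set t := condProb E ψ / meanProb E with ht
  have : 0 ≤ t := by positivity
  have ht_le : t ≤ d := (div_le_iff₀ hmean).2 hprob_le
  calc |condProb E ψ * Real.log t| = |t * Real.log t| * meanProb E := by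
        rw [← div_mul_cancel₀ (condProb E ψ) hmean.ne', ← ht, mul_right_comm, abs_mul,
          abs_of_pos hmean]
    _ ≤ (1 + (d : ℝ) ^ 2) * meanProb E := by
        gcongr
        exact (abs_mul_log_le t).trans (by gcongr)

theorem IsPOVM.integrable_info [SFinite ν] (h : IsPOVM ν F) :
    Integrable (fun z : (Fin d → ℂ) × X =>
      condProb (F z.2) z.1 * Real.log (condProb (F z.2) z.1 / meanProb (F z.2)))
      ((uniformEnsemble d).prod ν) := by
  have hprob : Measurable fun z : (Fin d → ℂ) × X => condProb (F z.2) z.1 :=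
    measurable_condProb (fun i j => (h.measurable i j).comp measurable_snd) measurable_fst
  have hmean : Measurable fun x => meanProb (F x) := by
    simp only [meanProb_eq]
    exact (Complex.measurable_re.comp
      (Finset.measurable_sum _ fun i _ => h.measurable i i)).div_const _
  have hmean_int : Integrable (fun x => meanProb (F x)) ν := by
    simpa only [meanProb_eq] using h.integrable_trace.div_const _
  refine ((hmean_int.const_mul (1 + (d : ℝ) ^ 2)).comp_snd (uniformEnsemble d)).mono'
    (hprob.mul (Real.measurable_log.comp
      (hprob.div (hmean.comp measurable_snd)))).aestronglyMeasurable ?_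
  filter_upwards [Measure.quasiMeasurePreserving_fst.ae ae_unit] with z hz
  exact abs_condProb_mul_log_le (h.posSemidef z.2) hz

theorem IsPOVM.information_eq [SFinite ν] (h : IsPOVM ν F) :
    information ν F = ∫ x, infoDensity (F x) ∂ν :=
  integral_integral_swap h.integrable_info

theorem IsPOVM.integrable_infoDensity [SFinite ν] (h : IsPOVM ν F) :
    Integrable (fun x => infoDensity (F x)) ν :=
  h.integrable_info.integral_prod_right

theorem IsProcedure.integrable_condProb [SFinite ν] (h : IsProcedure ν F 𝒜) :
    Integrable (fun z : (Fin d → ℂ) × X => condProb (𝒜 z.2 (ketbra z.1)) z.1)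
      ((uniformEnsemble d).prod ν) := by
  have hmeas (k l : Fin d) :
      Measurable fun z : (Fin d → ℂ) × X => 𝒜 z.2 (ketbra z.1) k l := by
    simp only [fun z : (Fin d → ℂ) × X => (h.compatible z.2).apply_eq_sum (ketbra z.1),
      Matrix.sum_apply, Matrix.smul_apply, smul_eq_mul]
    exact Finset.measurable_sum _ fun i _ => Finset.measurable_sum _ fun j _ =>
      ((continuous_ketbra.matrix_elem i j).measurable.comp measurable_fst).mul
        ((h.measurable _ k l).comp measurable_snd)
  refine (h.povm.integrable_trace.comp_snd (uniformEnsemble d)).mono'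
    (measurable_condProb hmeas measurable_fst).aestronglyMeasurable ?_
  filter_upwards [Measure.quasiMeasurePreserving_fst.ae ae_unit] with z hz
  have hpos := (h.compatible z.2).posSemidef (posSemidef_ketbra z.1)
  calc ‖condProb (𝒜 z.2 (ketbra z.1)) z.1‖
      = condProb (𝒜 z.2 (ketbra z.1)) z.1 := Real.norm_of_nonneg (condProb_nonneg hpos _)
    _ ≤ (𝒜 z.2 (ketbra z.1)).trace.re := condProb_le_trace hpos hz
    _ = condProb (F z.2) z.1 := by rw [(h.compatible z.2).trace_apply, condProb]
    _ ≤ (F z.2).trace.re := condProb_le_trace (h.povm.posSemidef _) hz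

theorem IsProcedure.integrable_integral_condProb [SFinite ν] (h : IsProcedure ν F 𝒜) :
    Integrable (fun x => ∫ ψ, condProb (𝒜 x (ketbra ψ)) ψ ∂(uniformEnsemble d)) ν :=
  Integrable.integral_prod_right
    (f := fun z : (Fin d → ℂ) × X => condProb (𝒜 z.2 (ketbra z.1)) z.1) h.integrable_condProb

theorem IsProcedure.disturbance_eq [SFinite ν] (h : IsProcedure ν F 𝒜) :
    disturbance ν 𝒜 =
      1 - ∫ x, ∫ ψ, condProb (𝒜 x (ketbra ψ)) ψ ∂(uniformEnsemble d) ∂ν := by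
  rw [disturbance, ← integral_integral_swap (f := fun ψ x => condProb (𝒜 x (ketbra ψ)) ψ)
    h.integrable_condProb]
  congr 1
  refine integral_congr_ae ?_
  filter_upwards [ae_unit] with ψ hψ
  exact integral_congr_ae (.of_forall fun x =>
    fidelity_ketbra hψ ((h.compatible x).posSemidef (posSemidef_ketbra ψ)))

theorem IsPOVM.disturbance_sqrtDynamics [SFinite ν] (h : IsPOVM ν F) :
    disturbance ν (sqrtDynamics F) = 1 - ∫ x, optimalFidelity (F x) ∂ν := by
  rw [h.isProcedure_sqrtDynamics.disturbance_eq]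
  simp only [sqrtDynamics, integral_condProb_sqrtOp (h.posSemidef _)]

theorem IsPOVM.integrable_optimalFidelity [SFinite ν] (h : IsPOVM ν F) :
    Integrable (fun x => optimalFidelity (F x)) ν :=
  h.isProcedure_sqrtDynamics.integrable_integral_condProb.congr
    (.of_forall fun x => integral_condProb_sqrtOp (h.posSemidef x))

theorem IsProcedure.le_disturbance [SFinite ν] (h : IsProcedure ν F 𝒜) :
    1 - ∫ x, optimalFidelity (F x) ∂ν ≤ disturbance ν 𝒜 := by
  rw [h.disturbance_eq]
  exact sub_le_sub_left (integral_mono h.integrable_integral_condProb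
    h.povm.integrable_optimalFidelity
    fun x => integral_condProb_le_optimalFidelity (h.compatible x)) _

end Densities

section Twirl

theorem posSemidef_twirl {X : Type*} {F : X → Op d} (hF : ∀ x, (F x).PosSemidef)
    (y : X × UGroup d) : (twirl F y).PosSemidef :=
  (hF y.1).mul_mul_conjTranspose_same _

theorem sqrtDynamics_twirl_mul_left {X : Type*} {F : X → Op d} (hF : ∀ x, (F x).PosSemidef)
    (W U : UGroup d) (x : X) (ρ : Op d) :
    sqrtDynamics (twirl F) (x, W * U) (W.1 * ρ * W.1ᴴ) =
      W.1 * sqrtDynamics (twirl F) (x, U) ρ * W.1ᴴ := by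
  have htwirl : twirl F (x, W * U) = W.1 * twirl F (x, U) * W.1ᴴ := (conj_conj W U (F x)).symm
  rw [sqrtDynamics, sqrtDynamics, htwirl, sqrtOp_conj W (posSemidef_twirl hF _), conj_mul_conj,
    conj_mul_conj]

variable {X : Type*} [MeasurableSpace X] {ν : Measure X} {F : X → Op d}

theorem measurable_twirl (hF : ∀ i j, Measurable fun x => F x i j) (i j : Fin d) :
    Measurable fun y => twirl F y i j := by
  have hU (i j : Fin d) : Measurable fun y : X × UGroup d => y.2.1 i j :=
    (measurable_unitary_apply i j).comp measurable_snd
  simp only [twirl, mul_apply, conjTranspose_apply]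
  exact Finset.measurable_sum _ fun k _ =>
    (Finset.measurable_sum _ fun l _ => (hU i l).mul ((hF l k).comp measurable_fst)).mul
      (continuous_star.measurable.comp (hU j k))

theorem IsPOVM.integrable_twirl (h : IsPOVM ν F) (i j : Fin d) :
    Integrable (fun y => twirl F y i j) (twirlMeasure d ν) := by
  refine (h.integrable_trace.comp_fst (haarU d)).mono'
    (measurable_twirl h.measurable i j).aestronglyMeasurable (.of_forall fun y => ?_)
  simpa only [twirl, trace_conj] using norm_apply_le_trace (posSemidef_twirl h.posSemidef y) i j

instance sFinite_twirlMeasure [SFinite ν] : SFinite (twirlMeasure d ν) :=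
  inferInstanceAs (SFinite (ν.prod (haarU d)))

variable [SFinite ν]

theorem IsPOVM.isPOVM_twirl (h : IsPOVM ν F) : IsPOVM (twirlMeasure d ν) (twirl F) where
  measurable := measurable_twirl h.measurable
  posSemidef := posSemidef_twirl h.posSemidef
  integrable := h.integrable_twirl
  integral_eq_one := by
    have hconj (U : UGroup d) : opIntegral ν (fun x => U.1 * F x * U.1ᴴ) = 1 := by
      rw [opIntegral_mul_mul h.integrable, h.integral_eq_one, Matrix.mul_one,
        coe_mul_conjTranspose]
    ext i j
    calc opIntegral (twirlMeasure d ν) (twirl F) i j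
        = ∫ U, opIntegral ν (fun x => U.1 * F x * U.1ᴴ) i j ∂(haarU d) :=
          integral_prod_symm _ (h.integrable_twirl i j)
      _ = (1 : Op d) i j := by simp [hconj]

theorem integral_comp_fst_twirlMeasure (f : X → ℝ) :
    ∫ y, f y.1 ∂(twirlMeasure d ν) = ∫ x, f x ∂ν := by
  rw [twirlMeasure, integral_fun_fst]
  simp

theorem IsPOVM.integral_optimalFidelity_twirl (h : IsPOVM ν F) :
    ∫ y, optimalFidelity (twirl F y) ∂(twirlMeasure d ν) = ∫ x, optimalFidelity (F x) ∂ν := by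
  simp only [twirl, optimalFidelity_conj _ (h.posSemidef _)]
  exact integral_comp_fst_twirlMeasure fun x => optimalFidelity (F x)

theorem IsPOVM.information_twirl [NeZero d] (h : IsPOVM ν F) :
    information (twirlMeasure d ν) (twirl F) = information ν F := by
  rw [h.isPOVM_twirl.information_eq, h.information_eq]
  simp only [twirl, infoDensity_conj]
  exact integral_comp_fst_twirlMeasure fun x => infoDensity (F x)

theorem IsPOVM.disturbance_twirl [NeZero d] (h : IsPOVM ν F) :
    disturbance (twirlMeasure d ν) (sqrtDynamics (twirl F)) = disturbance ν (sqrtDynamics F) := by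
  rw [h.isPOVM_twirl.disturbance_sqrtDynamics, h.integral_optimalFidelity_twirl,
    h.disturbance_sqrtDynamics]

end Twirl

section CovariantMaps

theorem trace_sqrtOp_sq_le {E : Op d} (hE : E.PosSemidef) :
    (sqrtOp E).trace.re ^ 2 ≤ d * E.trace.re := by
  obtain ⟨V, l, hl, rfl⟩ := exists_diagonalization hE
  rw [re_trace_sqrtOp_conj_diagOp V hl, trace_conj, trace_diagOp, Complex.ofReal_re]
  simpa [Real.sq_sqrt (hl _)] using
    sq_sum_le_card_mul_sum_sq (s := Finset.univ) (f := fun i => √(l i))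

theorem trace_le_trace_sqrtOp_sq {E : Op d} (hE : E.PosSemidef) :
    E.trace.re ≤ (sqrtOp E).trace.re ^ 2 := by
  obtain ⟨V, l, hl, rfl⟩ := exists_diagonalization hE
  rw [re_trace_sqrtOp_conj_diagOp V hl, trace_conj, trace_diagOp, Complex.ofReal_re]
  simpa [Real.sq_sqrt (hl _)] using
    Finset.sum_sq_le_sq_sum_of_nonneg (s := Finset.univ) fun i _ => Real.sqrt_nonneg (l i)

variable [NeZero d]

theorem one_le_natCast_sq : (1 : ℝ) ≤ (d : ℝ) ^ 2 :=
  one_le_pow₀ (Nat.one_le_cast.2 NeZero.one_le)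

/-- For `d = 1` the parameter is `0 / 0 = 0`. -/
theorem coe_eq_depolarizing_of_trace_eq {L : Op d →ₗ[ℂ] Op d} (hL : IsUnitarilyCovariant L)
    (htr : ∀ ρ, (L ρ).trace = ρ.trace) {s : ℝ} (hs : LinearMap.trace ℂ (Op d) L = s) :
    ⇑L = depolarizing (((d : ℝ) ^ 2 - s) / ((d : ℝ) ^ 2 - 1)) := by
  refine coe_eq_depolarizing hL htr fun hd => ?_
  have hd2 : (d : ℂ) ^ 2 - 1 ≠ 0 := by
    rw [sub_ne_zero]
    exact_mod_cast fun h : d ^ 2 = 1 => hd (by simpa using h)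
  rw [hs]
  push_cast
  rw [div_mul_cancel₀ _ hd2, sub_sub_cancel]

theorem isUnitarilyCovariant_channel_iff {𝒜 : Op d → Op d} (h : IsChannel 𝒜) :
    IsUnitarilyCovariant 𝒜 ↔
      ∃ p : ℝ, 0 ≤ p ∧ p * ((d : ℝ) ^ 2 - 1) ≤ (d : ℝ) ^ 2 ∧ 𝒜 = depolarizing p := by
  refine ⟨fun hcov => ?_, fun ⟨p, _, _, hp⟩ => hp ▸ isUnitarilyCovariant_depolarizing p⟩
  have htr (ρ : Op d) : (𝒜 ρ).trace = ρ.trace := by rw [h.trace_apply, Matrix.one_mul]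
  obtain ⟨r, A, hA, hone⟩ := h
  obtain rfl := hA.eq_krausMap
  set s := ∑ i, ‖(A i).trace‖ ^ 2
  have hs_nonneg : 0 ≤ s := Finset.sum_nonneg fun i _ => sq_nonneg _
  have hs_le : s ≤ (d : ℝ) ^ 2 :=
    calc s ≤ (sqrtOp (1 : Op d)).trace.re ^ 2 := hone ▸ sum_norm_trace_sq_le_trace_sqrtOp_sq A
      _ ≤ d * (1 : Op d).trace.re := trace_sqrtOp_sq_le .one
      _ = (d : ℝ) ^ 2 := by simp [sq]
  have hd2 : (0 : ℝ) ≤ (d : ℝ) ^ 2 - 1 := sub_nonneg.2 one_le_natCast_sq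
  exact ⟨_, div_nonneg (sub_nonneg.2 hs_le) hd2,
    (mul_le_of_le_div₀ (sub_nonneg.2 hs_le) hd2 le_rfl).trans (sub_le_self _ hs_nonneg),
    coe_eq_depolarizing_of_trace_eq hcov htr (by simp [superoperatorTrace_krausMap, s])⟩

end CovariantMaps

section OverallOperation

variable {X : Type*} [MeasurableSpace X] {ν : Measure X} {F : X → Op d} {𝒜 : X → Op d → Op d}

theorem IsPOVM.integrable_trace_mul (h : IsPOVM ν F) (ρ : Op d) :
    Integrable (fun x => (F x * ρ).trace) ν :=
  integrable_finsetSum _ fun i _ => by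
    simpa only [Matrix.one_mul, diag] using integrable_mul_mul h.integrable 1 ρ i i

theorem IsPOVM.integral_trace_mul (h : IsPOVM ν F) (ρ : Op d) :
    ∫ x, (F x * ρ).trace ∂ν = ρ.trace := by
  have hmul := opIntegral_mul_mul h.integrable 1 ρ
  have htr := trace_opIntegral fun i => integrable_mul_mul h.integrable 1 ρ i i
  simp only [Matrix.one_mul, h.integral_eq_one] at hmul htr
  rw [← htr, hmul]

theorem IsProcedure.integrable_apply (h : IsProcedure ν F 𝒜) (ρ : Op d) (i j : Fin d) :
    Integrable (fun x => 𝒜 x ρ i j) ν := by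
  have hpos {ρ : Op d} (hρ : ρ.PosSemidef) : Integrable (fun x => 𝒜 x ρ i j) ν := by
    refine (h.povm.integrable_trace_mul ρ).re.mono' (h.measurable ρ i j).aestronglyMeasurable
      (.of_forall fun x => ?_)
    exact (norm_apply_le_trace ((h.compatible x).posSemidef hρ) i j).trans_eq
      (congrArg Complex.re ((h.compatible x).trace_apply ρ))
  have hsingle : (single i i 1 : Op d).PosSemidef := by
    rw [← diagonal_single]
    exact .diagonal (Pi.single_nonneg.2 zero_le_one)
  have hspan := (span_conj_single i).symm ▸ Submodule.mem_top (x := ρ)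
  induction hspan using Submodule.span_induction with
  | mem ρ hρ =>
    obtain ⟨W, rfl⟩ := hρ
    exact hpos (hsingle.mul_mul_conjTranspose_same _)
  | zero => exact hpos .zero
  | add ρ σ _ _ hρ hσ =>
    simpa only [(h.compatible _).isLinearMap.map_add] using! hρ.add hσ
  | smul c ρ _ hρ =>
    simpa only [(h.compatible _).isLinearMap.map_smul] using! hρ.const_mul c

/-- The overall operation of a procedure, as a linear map. -/
noncomputable def IsProcedure.overallMap (h : IsProcedure ν F 𝒜) : Op d →ₗ[ℂ] Op d where
  toFun := overallOperation ν 𝒜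
  map_add' ρ σ := by
    simp only [overallOperation, (h.compatible _).isLinearMap.map_add]
    exact opIntegral_add (h.integrable_apply ρ) (h.integrable_apply σ)
  map_smul' c ρ := by
    simp only [overallOperation, (h.compatible _).isLinearMap.map_smul]
    exact opIntegral_smul c _

theorem IsProcedure.coe_overallMap (h : IsProcedure ν F 𝒜) :
    ⇑h.overallMap = overallOperation ν 𝒜 := rfl

theorem IsProcedure.trace_overallMap (h : IsProcedure ν F 𝒜) (ρ : Op d) :
    (h.overallMap ρ).trace = ρ.trace := by
  refine (trace_opIntegral fun i => h.integrable_apply ρ i i).trans ?_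
  simp only [(h.compatible _).trace_apply, h.povm.integral_trace_mul]

theorem sum_sqrtOp_mul_single_mul_sqrtOp_apply (E : Op d) :
    ∑ i, ∑ j, (sqrtOp E * single i j (1 : ℂ) * sqrtOp E : Op d) i j =
      (((sqrtOp E).trace.re ^ 2 : ℝ) : ℂ) := by
  have h := superoperatorTrace_krausMap fun _ : Fin 1 => sqrtOp E
  simp only [trace_superoperator, krausMap_sqrtOp, Finset.univ_unique, Finset.sum_singleton] at h
  rw [h, ← Complex.re_eq_norm.2 (posSemidef_sqrtOp E).trace_nonneg, Complex.ofReal_pow]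

theorem IsPOVM.integrable_sqrtDynamics (h : IsPOVM ν F) (ρ : Op d) (i j : Fin d) :
    Integrable (fun x => (sqrtOp (F x) * ρ * sqrtOp (F x)) i j) ν :=
  h.isProcedure_sqrtDynamics.integrable_apply ρ i j

theorem IsPOVM.integrable_trace_sqrtOp_sq (h : IsPOVM ν F) :
    Integrable (fun x => (sqrtOp (F x)).trace.re ^ 2) ν := by
  have hint : Integrable (fun x => ∑ i, ∑ j,
      (sqrtOp (F x) * single i j (1 : ℂ) * sqrtOp (F x) : Op d) i j) ν :=
    integrable_finsetSum _ fun i _ => integrable_finsetSum _ fun j _ =>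
      h.integrable_sqrtDynamics _ i j
  simp only [sum_sqrtOp_mul_single_mul_sqrtOp_apply] at hint
  exact hint.re

theorem IsPOVM.superoperatorTrace_overallMap_sqrtDynamics (h : IsPOVM ν F) :
    LinearMap.trace ℂ (Op d) h.isProcedure_sqrtDynamics.overallMap =
      (∫ x, (sqrtOp (F x)).trace.re ^ 2 ∂ν : ℝ) := by
  rw [trace_superoperator, ← integral_complex_ofReal]
  simp only [← sum_sqrtOp_mul_single_mul_sqrtOp_apply]
  rw [integral_finsetSum _ fun i _ => integrable_finsetSum _ fun j _ =>
    h.integrable_sqrtDynamics _ i j]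
  simp only [integral_finsetSum _ fun j _ => h.integrable_sqrtDynamics _ _ j]
  rfl

theorem IsPOVM.exists_overall_eq_depolarizing [NeZero d] (h : IsPOVM ν F)
    (hcov : IsUnitarilyCovariant (overallOperation ν (sqrtDynamics F))) :
    ∃ p ∈ Set.Icc (0 : ℝ) 1, overallOperation ν (sqrtDynamics F) = depolarizing p := by
  set s := ∫ x, (sqrtOp (F x)).trace.re ^ 2 ∂ν
  have hs_le : s ≤ (d : ℝ) ^ 2 :=
    calc s ≤ ∫ x, d * (F x).trace.re ∂ν :=
          integral_mono h.integrable_trace_sqrtOp_sq (h.integrable_trace.const_mul _) fun x =>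
            trace_sqrtOp_sq_le (h.posSemidef x)
      _ = (d : ℝ) ^ 2 := by rw [integral_const_mul, h.integral_trace, sq]
  have hs_ge : 1 ≤ s :=
    calc (1 : ℝ) ≤ d := Nat.one_le_cast.2 NeZero.one_le
      _ = ∫ x, (F x).trace.re ∂ν := h.integral_trace.symm
      _ ≤ s := integral_mono h.integrable_trace h.integrable_trace_sqrtOp_sq fun x =>
          trace_le_trace_sqrtOp_sq (h.posSemidef x)
  have hd2 : (0 : ℝ) ≤ (d : ℝ) ^ 2 - 1 := sub_nonneg.2 one_le_natCast_sq
  rw [← h.isProcedure_sqrtDynamics.coe_overallMap] at hcov ⊢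
  exact ⟨_, ⟨div_nonneg (sub_nonneg.2 hs_le) hd2,
    div_le_one_of_le₀ (sub_le_sub_left hs_ge _) hd2⟩,
    coe_eq_depolarizing_of_trace_eq hcov h.isProcedure_sqrtDynamics.trace_overallMap
      h.superoperatorTrace_overallMap_sqrtDynamics⟩

theorem IsPOVM.isUnitarilyCovariant_overall_twirl [SFinite ν] (h : IsPOVM ν F) :
    IsUnitarilyCovariant (overallOperation (twirlMeasure d ν) (sqrtDynamics (twirl F))) := by
  rw [isUnitarilyCovariant_iff]
  intro W ρ
  have hint := h.isPOVM_twirl.isProcedure_sqrtDynamics.integrable_apply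
  rw [overallOperation, overallOperation, ← opIntegral_mul_mul (hint ρ)]
  ext i j
  simp only [opIntegral, of_apply, twirlMeasure]
  rw [integral_prod _ (hint _ i j), integral_prod _ (integrable_mul_mul (hint ρ) _ _ i j)]
  congr 1
  ext x
  rw [← integral_mul_left_eq_self _ W]
  simp only [sqrtDynamics_twirl_mul_left h.posSemidef]

end OverallOperation

section FiniteEntropy

theorem continuous_condProb (E : Op d) : Continuous (condProb E) :=
  Complex.continuous_re.comp (continuous_trace_mul_ketbra E)

variable [NeZero d]

theorem condProb_eq_zero_of_meanProb_eq_zero {E : Op d} (hE : E.PosSemidef)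
    (h : meanProb E = 0) (ψ : Fin d → ℂ) : condProb E ψ = 0 := by
  have hd : (d : ℝ) ≠ 0 := NeZero.ne _
  rw [meanProb_eq, div_eq_zero_iff, or_iff_left hd] at h
  have hE0 : E = 0 := by
    rw [← hE.trace_eq_zero_iff, ← ofReal_re_trace hE, h, Complex.ofReal_zero]
  simp [condProb, hE0]

theorem integrable_negMulLog_condProb (E : Op d) :
    Integrable (fun ψ => Real.negMulLog (condProb E ψ)) (uniformEnsemble d) :=
  integrable_uniformEnsemble_of_continuous
    (Real.continuous_negMulLog.comp (continuous_condProb E))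

theorem infoDensity_eq {E : Op d} (hE : E.PosSemidef) :
    infoDensity E = Real.negMulLog (meanProb E) -
      ∫ ψ, Real.negMulLog (condProb E ψ) ∂(uniformEnsemble d) := by
  have hlog (ψ) : condProb E ψ * Real.log (condProb E ψ / meanProb E) =
      -Real.log (meanProb E) * condProb E ψ - Real.negMulLog (condProb E ψ) := by
    by_cases hprob : condProb E ψ = 0
    · simp [hprob]
    have hmean : meanProb E ≠ 0 := fun h =>
      hprob (condProb_eq_zero_of_meanProb_eq_zero hE h ψ)
    rw [Real.log_div hprob hmean, Real.negMulLog]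
    ring
  simp only [infoDensity, hlog]
  rw [integral_sub
    ((integrable_uniformEnsemble_of_continuous (continuous_condProb E)).const_mul _)
    (integrable_negMulLog_condProb E), integral_const_mul, ← meanProb, Real.negMulLog]
  ring

variable {B : Type*} [Fintype B] [MeasurableSpace B] [MeasurableSingletonClass B] {F : B → Op d}

theorem IsPOVM.information_count (h : IsPOVM Measure.count F) :
    information Measure.count F = ∑ b, infoDensity (F b) := by
  rw [h.information_eq, integral_count]

theorem IsPOVM.information_eq_outcomeEntropy_sub (h : IsPOVM Measure.count F) :
    information Measure.count F = outcomeEntropy F - condOutcomeEntropy F := by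
  rw [h.information_count, outcomeEntropy, condOutcomeEntropy,
    integral_finsetSum _ fun b _ => integrable_negMulLog_condProb (F b),
    ← Finset.sum_sub_distrib]
  exact Finset.sum_congr rfl fun b _ => infoDensity_eq (h.posSemidef b)

end FiniteEntropy

section ConvexHull

theorem convexHull_eq_iUnion_image {E : Type*} [AddCommGroup E] [Module ℝ E]
    [FiniteDimensional ℝ E] (K : Set E) :
    convexHull ℝ K = ⋃ n : Fin (Module.finrank ℝ E + 2),
      (fun z : (Fin n → ℝ) × (Fin n → E) => ∑ i, z.1 i • z.2 i) ''
        (stdSimplex ℝ (Fin n) ×ˢ Set.univ.pi fun _ => K) := by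
  refine Set.Subset.antisymm (fun x hx => ?_) (Set.iUnion_subset fun n => ?_)
  · obtain ⟨ι, _, z, w, hz, hind, hw, hw1, rfl⟩ := eq_pos_convex_span_of_mem_convexHull hx
    have hcard : Fintype.card ι < Module.finrank ℝ E + 2 :=
      Nat.lt_succ_of_le (hind.card_le_finrank_succ.trans
        (Nat.succ_le_succ (Submodule.finrank_le _)))
    let e := (Fintype.equivFin ι).symm
    exact Set.mem_iUnion.2 ⟨⟨_, hcard⟩, (w ∘ e, z ∘ e),
      ⟨⟨fun i => (hw (e i)).le, (e.sum_comp w).trans hw1⟩,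
        fun i _ => hz (Set.mem_range_self (e i))⟩, e.sum_comp fun i => w i • z i⟩
  · rintro _ ⟨⟨w, z⟩, ⟨hw, hz⟩, rfl⟩
    exact (convex_convexHull ℝ K).sum_mem (fun i _ => hw.1 i) hw.2
      fun i _ => subset_convexHull ℝ K (hz i (Set.mem_univ i))

variable {E : Type*} [NormedAddCommGroup E] [NormedSpace ℝ E]

theorem isCompact_convexHull [FiniteDimensional ℝ E] {K : Set E} (hK : IsCompact K) :
    IsCompact (convexHull ℝ K) := by
  rw [convexHull_eq_iUnion_image]
  refine isCompact_iUnion fun n => IsCompact.image ?_ (by fun_prop)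
  exact (isCompact_stdSimplex ℝ (Fin n)).prod (isCompact_univ_pi fun _ => hK)

theorem inv_integral_smul_integral_mem [CompleteSpace E] {X : Type*} [MeasurableSpace X]
    {ν : Measure X} {C : Set E} (hC : Convex ℝ C) (hC_closed : IsClosed C) {t : X → ℝ}
    {v : X → E} (ht : Integrable t ν) (hv : Integrable v ν) (hpos : 0 < ∫ x, t x ∂ν)
    (h : ∀ᵐ x ∂ν, 0 ≤ t x ∧ ∃ k ∈ C, v x = t x • k) :
    (∫ x, t x ∂ν)⁻¹ • ∫ x, v x ∂ν ∈ C := by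
  by_contra hmem
  obtain ⟨f, u, hfC, hfu⟩ := geometric_hahn_banach_closed_point hC hC_closed hmem
  have hle : ∀ᵐ x ∂ν, f (v x) ≤ t x * u := by
    filter_upwards [h] with x ⟨htx, k, hk, hvx⟩
    rw [hvx, map_smul, smul_eq_mul]
    exact mul_le_mul_of_nonneg_left (hfC k hk).le htx
  have hint := integral_mono_ae (f.integrable_comp hv) (ht.mul_const u) hle
  rw [f.integral_comp_comm hv, integral_mul_const] at hint
  rw [map_smul, smul_eq_mul, lt_inv_mul_iff₀ hpos] at hfu
  exact hfu.not_ge hint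

theorem exists_mem_stdSimplex_eq_sum_smul {n : Type*} [Fintype n] [Nonempty n] {l : n → ℝ}
    (hl : ∀ i, 0 ≤ l i) : ∃ m ∈ stdSimplex ℝ n, l = (∑ i, l i) • m := by
  classical
  have hsum : 0 ≤ ∑ i, l i := Finset.sum_nonneg fun i _ => hl i
  rcases hsum.eq_or_lt with hzero | hpos
  · refine ⟨Pi.single (Classical.arbitrary n) 1, single_mem_stdSimplex ℝ _, ?_⟩
    rw [← hzero, zero_smul]
    exact funext fun i =>
      (Finset.sum_eq_zero_iff_of_nonneg fun i _ => hl i).1 hzero.symm i (Finset.mem_univ i)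
  · refine ⟨(∑ i, l i)⁻¹ • l, ⟨fun i => mul_nonneg (inv_nonneg.2 hsum) (hl i), ?_⟩,
      (smul_inv_smul₀ hpos.ne' l).symm⟩
    simp only [Pi.smul_apply, smul_eq_mul, ← Finset.mul_sum]
    exact inv_mul_cancel₀ hpos.ne'

end ConvexHull

section InfoFidelity

theorem condProb_diagOp (l : Fin d → ℝ) (ψ : Fin d → ℂ) :
    condProb (diagOp l) ψ = ∑ i, l i * ‖ψ i‖ ^ 2 := by
  simp only [condProb, trace_mul_ketbra, diagOp, dotProduct, mulVec_diagonal, Pi.star_apply,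
    Complex.re_sum]
  refine Finset.sum_congr rfl fun i _ => ?_
  rw [mul_left_comm, Complex.star_def, Complex.conj_mul', Complex.re_ofReal_mul,
    ← Complex.ofReal_pow, Complex.ofReal_re]

theorem continuousOn_optimalFidelity_diagOp :
    ContinuousOn (fun l : Fin d → ℝ => optimalFidelity (diagOp l)) {l | ∀ i, 0 ≤ l i} := by
  have heq : Set.EqOn (fun l : Fin d → ℝ => optimalFidelity (diagOp l))
      (fun l => (∑ i, l i + (∑ i, √(l i)) ^ 2) / (d * (d + 1))) {l | ∀ i, 0 ≤ l i} := by
    intro l hl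
    simp only [optimalFidelity, sqrtOp_diagOp hl, trace_diagOp, Complex.ofReal_re]
  refine ContinuousOn.congr (Continuous.continuousOn ?_) heq
  fun_prop

variable [NeZero d]

theorem continuousOn_infoDensity_diagOp :
    ContinuousOn (fun l : Fin d → ℝ => infoDensity (diagOp l)) (stdSimplex ℝ (Fin d)) := by
  have heq : Set.EqOn (fun l : Fin d → ℝ => infoDensity (diagOp l))
      (fun l => Real.negMulLog (d : ℝ)⁻¹ -
        ∫ ψ, Real.negMulLog (∑ i, l i * ‖ψ i‖ ^ 2) ∂(uniformEnsemble d))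
      (stdSimplex ℝ (Fin d)) := by
    intro l hl
    simp only [infoDensity_eq (posSemidef_diagOp hl.1), meanProb_eq, trace_diagOp,
      Complex.ofReal_re, hl.2, condProb_diagOp, one_div]
  refine ContinuousOn.congr (continuousOn_const.sub ?_) heq
  refine continuousOn_of_dominated (bound := fun _ => 2) (fun l _ => ?_) (fun l hl => ?_)
    (integrable_const _) (.of_forall fun ψ => ?_)
  · exact (Real.continuous_negMulLog.comp (by fun_prop)).aestronglyMeasurable
  · filter_upwards [ae_unit] with ψ hψ
    have hnonneg := condProb_nonneg (posSemidef_diagOp hl.1) ψ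
    have hle_one := condProb_le_trace (posSemidef_diagOp hl.1) hψ
    rw [trace_diagOp, Complex.ofReal_re, hl.2] at hle_one
    rw [← condProb_diagOp, Real.negMulLog, Real.norm_eq_abs, neg_mul, abs_neg]
    exact (abs_mul_log_le _).trans (by nlinarith)
  · exact (Real.continuous_negMulLog.comp (by fun_prop)).continuousOn

/-- The contribution of an outcome with effect `E` to the information gain and to the fidelity of
the square-root dynamics. -/
noncomputable def infoFidelity (E : Op d) : ℝ × ℝ := (infoDensity E, optimalFidelity E)

theorem infoFidelity_conj (W : UGroup d) {E : Op d} (hE : E.PosSemidef) :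
    infoFidelity (W.1 * E * W.1ᴴ) = infoFidelity E := by
  rw [infoFidelity, infoDensity_conj, optimalFidelity_conj W hE, infoFidelity]

theorem infoFidelity_smul {c : ℝ} (hc : 0 ≤ c) {E : Op d} (hE : E.PosSemidef) :
    infoFidelity ((c : ℂ) • E) = c • infoFidelity E := by
  rw [infoFidelity, infoDensity_smul, optimalFidelity_smul hc hE, infoFidelity, Prod.smul_mk,
    smul_eq_mul, smul_eq_mul]

theorem infoFidelity_diagOp_comp_perm {l : Fin d → ℝ} (hl : ∀ i, 0 ≤ l i)
    (σ : Equiv.Perm (Fin d)) : infoFidelity (diagOp (l ∘ σ)) = infoFidelity (diagOp l) := by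
  rw [← infoFidelity_conj (permUnitary σ) (posSemidef_diagOp hl), permUnitary_conj, diagOp, diagOp,
    submatrix_diagonal _ _ σ.injective]
  rfl

variable (d) in
/-- The pairs of information density and optimal fidelity of the effects of unit trace; by unitary
invariance it suffices to consider diagonal effects. -/
def unitTraceRegion : Set (ℝ × ℝ) :=
  (fun l : Fin d → ℝ => infoFidelity (diagOp l)) '' stdSimplex ℝ (Fin d)

theorem isCompact_unitTraceRegion : IsCompact (unitTraceRegion d) :=
  (isCompact_stdSimplex ℝ (Fin d)).image_of_continuousOn
    (continuousOn_infoDensity_diagOp.prodMk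
      (continuousOn_optimalFidelity_diagOp.mono fun _ hl => hl.1))

theorem exists_infoFidelity_eq_smul {E : Op d} (hE : E.PosSemidef) :
    ∃ k ∈ unitTraceRegion d, infoFidelity E = E.trace.re • k := by
  obtain ⟨V, l, hl, rfl⟩ := exists_diagonalization hE
  obtain ⟨m, hm, hlm⟩ := exists_mem_stdSimplex_eq_sum_smul hl
  refine ⟨infoFidelity (diagOp m), ⟨m, hm, rfl⟩, ?_⟩
  rw [infoFidelity_conj V (posSemidef_diagOp hl), trace_conj, trace_diagOp, Complex.ofReal_re,
    ← infoFidelity_smul (Finset.sum_nonneg fun i _ => hl i) (posSemidef_diagOp hm.1),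
    ← diagOp_smul, ← hlm]

section Region

variable {X : Type*} [MeasurableSpace X] {ν : Measure X} [SFinite ν] {F : X → Op d}

theorem IsPOVM.integrable_infoFidelity (h : IsPOVM ν F) :
    Integrable (fun x => infoFidelity (F x)) ν :=
  h.integrable_infoDensity.prodMk h.integrable_optimalFidelity

theorem IsPOVM.integral_infoFidelity (h : IsPOVM ν F) :
    ∫ x, infoFidelity (F x) ∂ν = (information ν F, ∫ x, optimalFidelity (F x) ∂ν) := by
  rw [h.information_eq]
  exact integral_pair h.integrable_infoDensity h.integrable_optimalFidelity

theorem IsPOVM.inv_smul_information_mem (h : IsPOVM ν F) :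
    (d : ℝ)⁻¹ • (information ν F, ∫ x, optimalFidelity (F x) ∂ν) ∈
      convexHull ℝ (unitTraceRegion d) := by
  rw [← h.integral_infoFidelity, ← h.integral_trace]
  refine inv_integral_smul_integral_mem (convex_convexHull ℝ _)
    (isCompact_convexHull isCompact_unitTraceRegion).isClosed h.integrable_trace
    h.integrable_infoFidelity ?_ (.of_forall fun x => ⟨re_trace_nonneg (h.posSemidef x), ?_⟩)
  · rw [h.integral_trace]
    exact Nat.cast_pos.2 (NeZero.pos d)
  · obtain ⟨k, hk, hFx⟩ := exists_infoFidelity_eq_smul (h.posSemidef x)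
    exact ⟨k, subset_convexHull ℝ _ hk, hFx⟩

end Region

end InfoFidelity

section CyclicPOVM

theorem isPOVM_count {B : Type*} [Fintype B] [MeasurableSpace B] [MeasurableSingletonClass B]
    {G : B → Op d} (hG : ∀ b, (G b).PosSemidef) (hsum : ∑ b, G b = 1) :
    IsPOVM Measure.count G where
  measurable _ _ := measurable_of_finite _
  posSemidef := hG
  integrable _ _ := .of_finite
  integral_eq_one := by
    rw [← hsum]
    ext i j
    simp only [opIntegral, of_apply, integral_count, Matrix.sum_apply]

theorem sum_diagOp_comp_addRight {n : Type*} [Fintype n] [DecidableEq n] [AddGroup n]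
    (l : n → ℝ) : ∑ k, diagOp (l ∘ Equiv.addRight k) = ((∑ i, l i : ℝ) : ℂ) • 1 := by
  ext i j
  rw [Matrix.sum_apply]
  by_cases hij : i = j
  · subst hij
    simp only [diagOp, diagonal_apply_eq, Function.comp_apply, Equiv.coe_addRight,
      Matrix.smul_apply, one_apply_eq, smul_eq_mul, mul_one, Complex.ofReal_sum]
    exact Equiv.sum_comp (Equiv.addLeft i) fun k => (l k : ℂ)
  · simp [diagOp, hij]

variable [NeZero d] {ι : Type*} {w : ι → ℝ} {l : ι → Fin d → ℝ}

/-- All cyclic shifts of the diagonal effects with entries `l i`, weighted by `w i`: the shifts of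
one of them sum to a multiple of the identity. -/
noncomputable def cyclicPOVM (w : ι → ℝ) (l : ι → Fin d → ℝ) (b : ι × Fin d) : Op d :=
  (w b.1 : ℂ) • diagOp (l b.1 ∘ Equiv.addRight b.2)

theorem posSemidef_cyclicPOVM (hw : ∀ i, 0 ≤ w i) (hl : ∀ i j, 0 ≤ l i j) (b : ι × Fin d) :
    (cyclicPOVM w l b).PosSemidef :=
  (posSemidef_diagOp fun _ => hl b.1 _).smul (by exact_mod_cast hw b.1)

theorem infoFidelity_cyclicPOVM (hw : ∀ i, 0 ≤ w i) (hl : ∀ i j, 0 ≤ l i j) (b : ι × Fin d) :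
    infoFidelity (cyclicPOVM w l b) = w b.1 • infoFidelity (diagOp (l b.1)) := by
  have hpos : (diagOp (l b.1 ∘ Equiv.addRight b.2)).PosSemidef :=
    posSemidef_diagOp fun _ => hl b.1 _
  rw [cyclicPOVM, infoFidelity_smul (hw b.1) hpos, infoFidelity_diagOp_comp_perm (hl b.1)]

variable [Fintype ι]

theorem sum_cyclicPOVM (hw : ∑ i, w i = 1) (hl : ∀ i, ∑ j, l i j = 1) :
    ∑ b, cyclicPOVM w l b = 1 := by
  simp only [Fintype.sum_prod_type, cyclicPOVM, ← Finset.smul_sum, sum_diagOp_comp_addRight, hl,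
    Complex.ofReal_one, one_smul]
  rw [← Finset.sum_smul, ← Complex.ofReal_sum, hw, Complex.ofReal_one, one_smul]

theorem sum_infoFidelity_cyclicPOVM (hw : ∀ i, 0 ≤ w i) (hl : ∀ i j, 0 ≤ l i j) :
    ∑ b, infoFidelity (cyclicPOVM w l b) = (d : ℝ) • ∑ i, w i • infoFidelity (diagOp (l i)) := by
  simp only [infoFidelity_cyclicPOVM hw hl, Fintype.sum_prod_type, Finset.sum_const,
    Finset.card_univ, Fintype.card_fin, Finset.smul_sum, Nat.cast_smul_eq_nsmul]

theorem exists_isPOVM_integral_infoFidelity_eq {q : ℝ × ℝ}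
    (hq : q ∈ convexHull ℝ (unitTraceRegion d)) :
    ∃ (n : ℕ) (G : Fin n → Op d), IsPOVM Measure.count G ∧
      ∫ b, infoFidelity (G b) ∂Measure.count = (d : ℝ) • q := by
  obtain ⟨ι, _, w, z, hw, hw1, hz, rfl⟩ := mem_convexHull_iff_exists_fintype.1 hq
  choose l hl hlz using hz
  let e := (Fintype.equivFin (ι × Fin d)).symm
  refine ⟨_, cyclicPOVM w l ∘ e,
    isPOVM_count (fun b => posSemidef_cyclicPOVM hw (fun i => (hl i).1) (e b)) ?_, ?_⟩
  · exact (e.sum_comp _).trans (sum_cyclicPOVM hw1 fun i => (hl i).2)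
  · rw [integral_count]
    simp only [← hlz, ← sum_infoFidelity_cyclicPOVM hw fun i => (hl i).1]
    exact e.sum_comp fun b => infoFidelity (cyclicPOVM w l b)

end CyclicPOVM

section Optimal

variable [NeZero d] {X : Type*} [MeasurableSpace X] {ν : Measure X} [SFinite ν] {F : X → Op d}

theorem IsPOVM.exists_finite_optimal (h : IsPOVM ν F) :
    ∃ (n : ℕ) (G : Fin n → Op d), IsPOVM Measure.count G ∧
      information Measure.count G = information ν F ∧
      ∀ {Y : Type*} [MeasurableSpace Y] (κ : Measure Y) [SFinite κ] (E : Y → Op d),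
        IsPOVM κ E → information κ E = information ν F →
        ∫ y, optimalFidelity (E y) ∂κ ≤ ∫ b, optimalFidelity (G b) ∂Measure.count := by
  have hd : (0 : ℝ) < d := Nat.cast_pos.2 (NeZero.pos d)
  have hcompact : IsCompact
      (convexHull ℝ (unitTraceRegion d) ∩ {q | q.1 = (d : ℝ)⁻¹ * information ν F}) :=
    (isCompact_convexHull isCompact_unitTraceRegion).inter_right
      (isClosed_eq continuous_fst continuous_const)
  obtain ⟨q, ⟨hq, hq_info⟩, hmax⟩ := hcompact.exists_isMaxOn
    ⟨_, h.inv_smul_information_mem, rfl⟩ continuous_snd.continuousOn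
  obtain ⟨n, G, hG, hGq⟩ := exists_isPOVM_integral_infoFidelity_eq hq
  rw [hG.integral_infoFidelity] at hGq
  obtain ⟨hG_info, hG_fid⟩ := Prod.ext_iff.1 hGq
  simp only [Prod.smul_fst, Prod.smul_snd, smul_eq_mul] at hG_info hG_fid
  refine ⟨n, G, hG, ?_, fun κ _ E hE hEi => ?_⟩
  · rw [hG_info, hq_info, mul_inv_cancel_left₀ hd.ne']
  · rw [hG_fid, ← inv_mul_le_iff₀ hd]
    exact hmax (a := (d : ℝ)⁻¹ • (information κ E, ∫ y, optimalFidelity (E y) ∂κ))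
      ⟨hE.inv_smul_information_mem, congrArg _ hEi⟩

theorem IsPOVM.isLeast_disturbance (h : IsPOVM ν F) :
    IsLeast {D | ∃ 𝒜 : X → Op d → Op d, IsProcedure ν F 𝒜 ∧ D = disturbance ν 𝒜}
      (disturbance ν (sqrtDynamics F)) := by
  refine ⟨⟨_, h.isProcedure_sqrtDynamics, rfl⟩, ?_⟩
  rintro _ ⟨𝒜, h𝒜, rfl⟩
  rw [h.disturbance_sqrtDynamics]
  exact h𝒜.le_disturbance

end Optimal

end QuantumMeasurement

theorem mainTheorem3 {d : ℕ} [NeZero d] :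
    -- every achievable information gain is achieved with minimal disturbance by the square-root
    -- dynamics of the Haar twirl of a finite POVM, and the overall operation is covariant
    (∀ {X : Type*} [MeasurableSpace X] (ν : Measure X) [SigmaFinite ν] (F : X → Op d)
        (𝒜 : X → Op d → Op d), IsProcedure ν F 𝒜 →
      ∃ (n : ℕ) (G : Fin n → Op d),
        IsPOVM Measure.count G ∧
        IsProcedure (twirlMeasure d Measure.count) (twirl G) (sqrtDynamics (twirl G)) ∧
        information (twirlMeasure d Measure.count) (twirl G) = information ν F ∧
        (∀ {Y : Type*} [MeasurableSpace Y] (κ : Measure Y) [SigmaFinite κ] (E : Y → Op d)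
            (ℬ : Y → Op d → Op d), IsProcedure κ E ℬ → information κ E = information ν F →
          disturbance (twirlMeasure d Measure.count) (sqrtDynamics (twirl G)) ≤
            disturbance κ ℬ) ∧
        IsUnitarilyCovariant
          (overallOperation (twirlMeasure d Measure.count) (sqrtDynamics (twirl G))) ∧
        ∃ p ∈ Set.Icc (0 : ℝ) 1,
          overallOperation (twirlMeasure d Measure.count) (sqrtDynamics (twirl G)) =
            depolarizing p) ∧
    -- for every POVM, the square-root dynamics of its Haar twirl is a covariant procedure with
    -- the same information and with the minimal disturbance, both among the instruments of the
    -- original POVM and among those of the twirled one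
    (∀ {X : Type*} [MeasurableSpace X] (ν : Measure X) [SigmaFinite ν] (F : X → Op d),
      IsPOVM ν F →
        IsProcedure (twirlMeasure d ν) (twirl F) (sqrtDynamics (twirl F)) ∧
        information (twirlMeasure d ν) (twirl F) = information ν F ∧
        IsLeast {D | ∃ 𝒜 : X → Op d → Op d, IsProcedure ν F 𝒜 ∧ D = disturbance ν 𝒜}
          (disturbance (twirlMeasure d ν) (sqrtDynamics (twirl F))) ∧
        IsLeast {D | ∃ 𝒜 : X × UGroup d → Op d → Op d,
            IsProcedure (twirlMeasure d ν) (twirl F) 𝒜 ∧ D = disturbance (twirlMeasure d ν) 𝒜}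
          (disturbance (twirlMeasure d ν) (sqrtDynamics (twirl F))) ∧
        IsUnitarilyCovariant
          (overallOperation (twirlMeasure d ν) (sqrtDynamics (twirl F))) ∧
        ∃ p ∈ Set.Icc (0 : ℝ) 1,
          overallOperation (twirlMeasure d ν) (sqrtDynamics (twirl F)) = depolarizing p) ∧
    -- for finite POVMs the information is the mutual information `H(B) - H(B|Ψ)`
    (∀ (n : ℕ) (F : Fin n → Op d), IsPOVM Measure.count F →
      information Measure.count F = outcomeEntropy F - condOutcomeEntropy F) ∧
    -- the unitarily covariant channels are depolarizing maps
    (∀ 𝒜 : Op d → Op d, IsChannel 𝒜 →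
      (IsUnitarilyCovariant 𝒜 ↔
        ∃ p : ℝ, 0 ≤ p ∧ p * ((d : ℝ) ^ 2 - 1) ≤ (d : ℝ) ^ 2 ∧ 𝒜 = depolarizing p)) := by
  refine ⟨fun {_} _ ν _ F 𝒜 h => ?_, fun {_} _ ν _ F h => ?_,
    fun _ _ h => h.information_eq_outcomeEntropy_sub, fun _ h => isUnitarilyCovariant_channel_iff h⟩
  · obtain ⟨n, G, hG, hG_info, hG_opt⟩ := h.povm.exists_finite_optimal
    have hcov := hG.isUnitarilyCovariant_overall_twirl
    refine ⟨n, G, hG, hG.isPOVM_twirl.isProcedure_sqrtDynamics, hG.information_twirl.trans hG_info,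
      fun κ _ E ℬ hE hE_info => ?_, hcov, hG.isPOVM_twirl.exists_overall_eq_depolarizing hcov⟩
    rw [hG.disturbance_twirl, hG.disturbance_sqrtDynamics]
    exact (sub_le_sub_left (hG_opt κ E hE.povm hE_info) 1).trans hE.le_disturbance
  · have hcov := h.isUnitarilyCovariant_overall_twirl
    exact ⟨h.isPOVM_twirl.isProcedure_sqrtDynamics, h.information_twirl,
      h.disturbance_twirl ▸ h.isLeast_disturbance, h.isPOVM_twirl.isLeast_disturbance, hcov,
      h.isPOVM_twirl.exists_overall_eq_depolarizing hcov⟩
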